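/- **Setting.** Fix a countably infinite set $\Delta$ of data values. A schema $\mathcal R$ is a finite set of relation names with arities; relations of arity $0$ are called propositions. A database instance is a set of facts $R(e_1,\dots,e_a)$ with $R/a\in\mathcal R$ and $e_i\in\Delta$; its active domain $\mathrm{adom}(I)$ is the set of values that occur in its facts. Queries are first-order formulas with equality over $\mathcal R$, with quantifiers ranging over $\mathrm{adom}(I)$. A UCQ is a disjunction of conjunctive queries (existentially quantified conjunctions of atoms) with the same free variables. A *database-manipulating system* (DMS) over $\mathcal R$ is a pair $\mathcal S=\langle I_0,\mathrm{acts}\rangle$, where $I_0$ is a set of propositions and $\mathrm{acts}$ is a finite set of actions $\alpha=\langle\vec u,\vec v,Q,\mathit{Del},\mathit{Add}\rangle$: $\vec u,\vec v$ are disjoint finite sets of variables, the guard $Q$ is a query whose set of free variables is $\vec u$, $\mathit{Del}$ is a finite set of facts over the variables $\vec u$, and $\mathit{Add}$ is a finite set of facts over $\vec u\cup\vec v$ in which every variable of $\vec v$ occurs. A configuration is a pair $(I,H)$ of an instance and a set $H\subseteq\Delta$. There is a step $(I,H)\to(I',H')$ if for some $\alpha\in\mathrm{acts}$ and $\sigma:\vec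 u\cup\vec v\to\Delta$: $\sigma(\vec u)\subseteq\mathrm{adom}(I)$, $\sigma(\vec v)\cap H=\emptyset$, $\sigma$ is injective on $\vec v$, $I,\sigma|_{\vec u}\models Q$, $I'=(I\setminus\sigma(\mathit{Del}))\cup\sigma(\mathit{Add})$ and $H'=H\cup\sigma(\vec v)$. A *run* is the sequence $I_0,I_1,\dots$ of instances along an infinite path of steps starting in $(I_0,\emptyset)$. *MSO-FO* formulas are $\varphi::=Q@x\mid x<y\mid x\in X\mid\neg\varphi\mid\varphi\wedge\varphi\mid\exists x.\varphi\mid\exists X.\varphi\mid\exists^g u.\varphi$, where $Q$ is a query. They are interpreted over runs $\rho=I_0,I_1,\dots$: $x,y$ range over positions in $\mathbb N$, $X$ over sets of positions, $\exists^g u$ over $\bigcup_i\mathrm{adom}(I_i)$, and $Q@x$ says that the free variables of $Q$ take values in $\mathrm{adom}(I_x)$ and that $Q$ holds in $I_x$. Consider three decision problems (inputs are finite objects in a standard encoding): * *Model checking*: given a DMS $\mathcal S$ and an MSO-FO sentence $\varphi$ over its schema, does $\varphi$ hold in every run of $\mathcal S$? * *Propositional reachability*: given a DMS $\mathcal S$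 and a proposition $p$ of its schema, does some finite sequence of steps from $(I_0,\emptyset)$ end in a configuration whose instance contains $p$? * *Propositional reachability along runs*: given a DMS $\mathcal S$ and a proposition $p$ of its schema, does $p$ belong to some instance of some run of $\mathcal S$? **Theorem 4.1.** Each of these three problems is undecidable. Moreover, let $N$ be a finite list of positive integers, and consider only the DMSs whose non-nullary relations have exactly the arities listed in $N$ (with any number of propositions). 1. If $N$ contains the arity $2$, each of the three problems is undecidable even for those of these DMSs whose guards are all UCQs. 2. If $N$ contains the arity $1$ at least twice, each of the three problems, with arbitrary first-order guards, is undecidable for these DMSs. -/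

import Mathlib

/-! ### Queries: first-order logic with equality over a relational schema -/

/-- A relational schema, given by the list of the arities of its relations.  The relation names are
the positions `0, 1, ..., length - 1` of the list, and a relation of arity `0` is a proposition. -/
abbrev Schema := List ℕ

/-- A fact `R(e₁, ..., eₐ)` with entries in `X` (data values, or data variables): the name of the
relation together with the tuple of its entries. -/
abbrev DBFact (X : Type*) := ℕ × List X

/-- The relation of the fact belongs to the schema, and the tuple has the right length. -/
def DBFact.Over {X : Type*} (f : DBFact X) (R : Schema) : Prop := R[f.1]? = some f.2.length

/-- First-order queries with equality; data variables are natural numbers. -/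
inductive Query : Type where
  | tru : Query
  | rel (r : ℕ) (us : List ℕ) : Query
  | eq (u v : ℕ) : Query
  | neg (q : Query) : Query
  | and (q₁ q₂ : Query) : Query
  | ex (u : ℕ) (q : Query) : Query

namespace Query

/-- Disjunction, as the usual abbreviation. -/
def or (q₁ q₂ : Query) : Query := neg (and (neg q₁) (neg q₂))

/-- The free variables of a query. -/
def free : Query → Finset ℕ
  | tru => ∅
  | rel _ us => us.toFinset
  | eq u v => {u, v}
  | neg q => q.free
  | and q₁ q₂ => q₁.free ∪ q₂.free
  | ex u q => q.free.erase u

/-- All relational atoms of the query are over the schema. -/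
def Over (R : Schema) : Query → Prop
  | tru => True
  | rel r us => DBFact.Over (r, us) R
  | eq _ _ => True
  | neg q => q.Over R
  | and q₁ q₂ => q₁.Over R ∧ q₂.Over R
  | ex _ q => q.Over R

/-- Conjunctions of atoms. -/
inductive IsConj : Query → Prop where
  | tru : IsConj tru
  | rel (r : ℕ) (us : List ℕ) : IsConj (rel r us)
  | eq (u v : ℕ) : IsConj (eq u v)
  | and {q₁ q₂ : Query} : IsConj q₁ → IsConj q₂ → IsConj (and q₁ q₂)

/-- Conjunctive queries: existentially quantified conjunctions of atoms. -/
inductive IsCQ : Query → Prop where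
  | conj {q : Query} : IsConj q → IsCQ q
  | ex {q : Query} (u : ℕ) : IsCQ q → IsCQ (ex u q)

/-- Unions of conjunctive queries: disjunctions of conjunctive queries that have the same free
variables. -/
inductive IsUCQ : Query → Prop where
  | cq {q : Query} : IsCQ q → IsUCQ q
  | or {q₁ q₂ : Query} : IsUCQ q₁ → IsUCQ q₂ → q₁.free = q₂.free → IsUCQ (or q₁ q₂)

end Query

/-- A database instance over the data domain `Δ`: a set of facts. -/
abbrev DB (Δ : Type*) := Set (DBFact Δ)

/-- The active domain of a database instance: the values that occur in its facts. -/
def DB.adom {Δ : Type*} (I : DB Δ) : Set Δ := {e | ∃ f ∈ I, e ∈ f.2}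

/-- `q.Sat I σ`: the query `q` holds in `I` under the substitution `σ`.  Only the values of `σ` at
the free variables of `q` matter.  Quantifiers range over the active domain of `I`. -/
def Query.Sat {Δ : Type*} (I : DB Δ) : Query → (ℕ → Δ) → Prop
  | .tru, _ => True
  | .rel r us, σ => (r, us.map σ) ∈ I
  | .eq u v, σ => σ u = σ v
  | .neg q, σ => ¬ q.Sat I σ
  | .and q₁ q₂, σ => q₁.Sat I σ ∧ q₂.Sat I σ
  | .ex u q, σ => ∃ e ∈ I.adom, q.Sat I (Function.update σ u e)

/-! ### Database-manipulating systems -/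

/-- A guarded action: action parameters, fresh-input variables, guard, facts to be deleted and facts
to be added.  The lists stand for the finite sets of their members. -/
structure DMSAction : Type where
  params : List ℕ
  fresh : List ℕ
  guard : Query
  del : List (DBFact ℕ)
  add : List (DBFact ℕ)

/-- The conditions that make the tuple an action over the schema `R`. -/
structure DMSAction.WF (α : DMSAction) (R : Schema) : Prop where
  disjoint : ∀ u ∈ α.params, u ∉ α.fresh
  guard_over : α.guard.Over R
  params_eq : ∀ u, u ∈ α.params ↔ u ∈ α.guard.free
  del_over : ∀ f ∈ α.del, f.Over R
  del_vars : ∀ f ∈ α.del, ∀ u ∈ f.2, u ∈ α.params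
  add_over : ∀ f ∈ α.add, f.Over R
  add_vars : ∀ f ∈ α.add, ∀ u ∈ f.2, u ∈ α.params ∨ u ∈ α.fresh
  fresh_used : ∀ v ∈ α.fresh, ∃ f ∈ α.add, v ∈ f.2

/-- A database-manipulating system: a schema, the list of the propositions that hold initially, and
the list of the actions. -/
structure DMS : Type where
  schema : Schema
  init : List ℕ
  acts : List DMSAction

/-- `p` is a proposition (a nullary relation) of the schema. -/
def Schema.IsProp (R : Schema) (p : ℕ) : Prop := R[p]? = some 0

/-- The conditions that make the tuple a database-manipulating system over its schema. -/
structure DMS.WF (S : DMS) : Prop where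
  init_prop : ∀ p ∈ S.init, Schema.IsProp S.schema p
  acts_wf : ∀ α ∈ S.acts, α.WF S.schema

/-- The proposition `p` is true in `I`. -/
def DB.Holds {Δ : Type*} (I : DB Δ) (p : ℕ) : Prop := ((p, []) : DBFact Δ) ∈ I

/-- The database instance obtained from a finite set of facts over variables by the
substitution `σ`. -/
def substDB {Δ : Type*} (σ : ℕ → Δ) (F : List (DBFact ℕ)) : DB Δ :=
  {f | ∃ g ∈ F, f = (g.1, g.2.map σ)}

/-- A configuration: the current database instance and the history set. -/
abbrev Config (Δ : Type*) := DB Δ × Set Δ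

/-- `σ` is an instantiating substitution for `α` at the configuration `c`.  Only the values of `σ` at
the parameters and the fresh-input variables of `α` matter. -/
structure DMSAction.Instantiates {Δ : Type*} (α : DMSAction) (c : Config Δ) (σ : ℕ → Δ) : Prop where
  active : ∀ u ∈ α.params, σ u ∈ c.1.adom
  hist_fresh : ∀ v ∈ α.fresh, σ v ∉ c.2
  inj : ∀ v ∈ α.fresh, ∀ w ∈ α.fresh, σ v = σ w → v = w
  sat : α.guard.Sat c.1 σ

namespace DMS

/-- The edges of the configuration graph. -/
def Step {Δ : Type*} (S : DMS) (c c' : Config Δ) : Prop :=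
  ∃ α ∈ S.acts, ∃ σ : ℕ → Δ, α.Instantiates c σ ∧
    c'.1 = (c.1 \ substDB σ α.del) ∪ substDB σ α.add ∧
    c'.2 = c.2 ∪ {e | ∃ v ∈ α.fresh, σ v = e}

/-- The initial database instance. -/
def initDB (Δ : Type*) (S : DMS) : DB Δ := {f | ∃ p ∈ S.init, f = (p, [])}

/-- The runs of `S`: the infinite sequences of database instances along the infinite paths of the
configuration graph that start in the initial configuration. -/
def IsRun {Δ : Type*} (S : DMS) (ρ : ℕ → DB Δ) : Prop :=
  ∃ H : ℕ → Set Δ, ρ 0 = S.initDB Δ ∧ H 0 = ∅ ∧ ∀ i, S.Step (ρ i, H i) (ρ (i + 1), H (i + 1))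

/-- Propositional reachability: some finite execution from the initial configuration ends in a
database instance in which `p` is true. -/
def PropReach (Δ : Type*) (S : DMS) (p : ℕ) : Prop :=
  ∃ c : Config Δ, Relation.ReflTransGen S.Step (S.initDB Δ, ∅) c ∧ c.1.Holds p

/-- Propositional reachability along runs: some (infinite) run contains a database instance in
which `p` is true. -/
def RunReach (Δ : Type*) (S : DMS) (p : ℕ) : Prop :=
  ∃ ρ : ℕ → DB Δ, S.IsRun ρ ∧ ∃ i, (ρ i).Holds p

end DMS

/-! ### The logic MSO-FO -/

/-- Formulae of MSO-FO.  The three sorts of variables (first-order position variables, second-order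
position variables, data variables) are three separate copies of the natural numbers. -/
inductive MSOFO : Type where
  | holdsAt (q : Query) (x : ℕ) : MSOFO
  | lt (x y : ℕ) : MSOFO
  | mem (x X : ℕ) : MSOFO
  | neg (φ : MSOFO) : MSOFO
  | and (φ₁ φ₂ : MSOFO) : MSOFO
  | exPos (x : ℕ) (φ : MSOFO) : MSOFO
  | exSet (X : ℕ) (φ : MSOFO) : MSOFO
  | exData (u : ℕ) (φ : MSOFO) : MSOFO

namespace MSOFO

/-- The free first-order position variables. -/
def freePos : MSOFO → Finset ℕ
  | holdsAt _ x => {x}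
  | lt x y => {x, y}
  | mem x _ => {x}
  | neg φ => φ.freePos
  | and φ₁ φ₂ => φ₁.freePos ∪ φ₂.freePos
  | exPos x φ => φ.freePos.erase x
  | exSet _ φ => φ.freePos
  | exData _ φ => φ.freePos

/-- The free second-order position variables. -/
def freeSet : MSOFO → Finset ℕ
  | holdsAt _ _ => ∅
  | lt _ _ => ∅
  | mem _ X => {X}
  | neg φ => φ.freeSet
  | and φ₁ φ₂ => φ₁.freeSet ∪ φ₂.freeSet
  | exPos _ φ => φ.freeSet
  | exSet X φ => φ.freeSet.erase X
  | exData _ φ => φ.freeSet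

/-- The free data variables. -/
def freeData : MSOFO → Finset ℕ
  | holdsAt q _ => q.free
  | lt _ _ => ∅
  | mem _ _ => ∅
  | neg φ => φ.freeData
  | and φ₁ φ₂ => φ₁.freeData ∪ φ₂.freeData
  | exPos _ φ => φ.freeData
  | exSet _ φ => φ.freeData
  | exData u φ => φ.freeData.erase u

/-- The formula has no free variables. -/
def IsSentence (φ : MSOFO) : Prop := φ.freePos = ∅ ∧ φ.freeSet = ∅ ∧ φ.freeData = ∅

/-- All queries of the formula are over the schema. -/
def Over (R : Schema) : MSOFO → Prop
  | holdsAt q _ => q.Over R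
  | lt _ _ => True
  | mem _ _ => True
  | neg φ => φ.Over R
  | and φ₁ φ₂ => φ₁.Over R ∧ φ₂.Over R
  | exPos _ φ => φ.Over R
  | exSet _ φ => φ.Over R
  | exData _ φ => φ.Over R

/-- `φ.Sat ρ x X d`: the formula `φ` holds in `ρ` under the substitution given by `x`, `X`, `d` on
first-order position variables, second-order position variables and data variables.  For `Q@x` the
free variables of `Q` have to be interpreted in the active domain of the instance at position `x`;
the data quantifier ranges over the global active domain of `ρ`. -/
def Sat {Δ : Type*} (ρ : ℕ → DB Δ) : MSOFO → (ℕ → ℕ) → (ℕ → Set ℕ) → (ℕ → Δ) → Prop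
  | holdsAt q y, x, _, d => (∀ u ∈ q.free, d u ∈ (ρ (x y)).adom) ∧ q.Sat (ρ (x y)) d
  | lt y z, x, _, _ => x y < x z
  | mem y Y, x, X, _ => x y ∈ X Y
  | neg φ, x, X, d => ¬ φ.Sat ρ x X d
  | and φ₁ φ₂, x, X, d => φ₁.Sat ρ x X d ∧ φ₂.Sat ρ x X d
  | exPos y φ, x, X, d => ∃ i : ℕ, φ.Sat ρ (Function.update x y i) X d
  | exSet Y φ, x, X, d => ∃ J : Set ℕ, φ.Sat ρ x (Function.update X Y J) d
  | exData u φ, x, X, d => ∃ e, (∃ i, e ∈ (ρ i).adom) ∧ φ.Sat ρ x X (Function.update d u e)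

end MSOFO

/-- Model checking: the sentence `φ` holds in every run of `S`.  (The truth value of a sentence does
not depend on the substitution.) -/
def DMS.Models (Δ : Type*) (S : DMS) (φ : MSOFO) : Prop :=
  ∀ ρ : ℕ → DB Δ, S.IsRun ρ → ∀ x X d, φ.Sat ρ x X d

/-! ### Encoding of the inputs by natural numbers -/

/-- The Gödel number of a query. -/
def Query.code : Query → ℕ
  | tru => 0
  | rel r us => 5 * Encodable.encode (r, us) + 1
  | eq u v => 5 * Nat.pair u v + 2
  | neg q => 5 * q.code + 3
  | and q₁ q₂ => 5 * Nat.pair q₁.code q₂.code + 4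
  | ex u q => 5 * Nat.pair u q.code + 5

theorem Query.code_injective : Function.Injective Query.code := by
  intro a
  induction a with
  | tru => intro b h; cases b <;> simp only [Query.code] at h <;> first | rfl | omega
  | rel r us =>
    intro b h
    cases b <;> simp only [Query.code] at h <;> try omega
    rename_i r' us'
    have := Encodable.encode_injective
      (show Encodable.encode (r, us) = Encodable.encode (r', us') by omega)
    simp_all
  | eq u v =>
    intro b h
    cases b with
    | eq u' v' =>
      simp only [Query.code] at h
      have := Nat.pair_eq_pair.1 (show Nat.pair u v = Nat.pair u' v' by omega)
      simp_all
    | _ => simp only [Query.code] at h; omega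
  | neg q ih =>
    intro b h
    cases b with
    | neg q' =>
      simp only [Query.code] at h
      rw [ih (show q.code = q'.code by omega)]
    | _ => simp only [Query.code] at h; omega
  | and q₁ q₂ ih₁ ih₂ =>
    intro b h
    cases b with
    | and q₁' q₂' =>
      simp only [Query.code] at h
      obtain ⟨h₁, h₂⟩ := Nat.pair_eq_pair.1
        (show Nat.pair q₁.code q₂.code = Nat.pair q₁'.code q₂'.code by omega)
      rw [ih₁ h₁, ih₂ h₂]
    | _ => simp only [Query.code] at h; omega
  | ex u q ih =>
    intro b h
    cases b with
    | ex u' q' =>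
      simp only [Query.code] at h
      obtain ⟨h₁, h₂⟩ := Nat.pair_eq_pair.1
        (show Nat.pair u q.code = Nat.pair u' q'.code by omega)
      rw [h₁, ih h₂]
    | _ => simp only [Query.code] at h; omega

theorem Query.code_surjective : Function.Surjective Query.code := by
  intro n
  induction n using Nat.strong_induction_on with
  | _ n ih =>
    rcases Nat.eq_zero_or_pos n with rfl | hn
    · exact ⟨.tru, rfl⟩
    obtain ⟨k, i, hi, rfl⟩ : ∃ k i, i < 5 ∧ n = 5 * k + i + 1 :=
      ⟨(n - 1) / 5, (n - 1) % 5, Nat.mod_lt _ (by norm_num), by omega⟩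
    have hl := Nat.unpair_left_le k
    have hr := Nat.unpair_right_le k
    have hp := Nat.pair_unpair k
    interval_cases i
    · refine ⟨.rel (Denumerable.ofNat (ℕ × List ℕ) k).1 (Denumerable.ofNat (ℕ × List ℕ) k).2, ?_⟩
      simp only [Query.code, Prod.mk.eta, Denumerable.encode_ofNat, Nat.add_zero]
    · exact ⟨.eq k.unpair.1 k.unpair.2, by simp only [Query.code]; omega⟩
    · obtain ⟨q, hq⟩ := ih k (by omega)
      exact ⟨.neg q, by simp only [Query.code]; omega⟩
    · obtain ⟨q₁, h₁⟩ := ih k.unpair.1 (by omega)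
      obtain ⟨q₂, h₂⟩ := ih k.unpair.2 (by omega)
      exact ⟨.and q₁ q₂, by simp only [Query.code, h₁, h₂]; omega⟩
    · obtain ⟨q, hq⟩ := ih k.unpair.2 (by omega)
      exact ⟨.ex k.unpair.1 q, by simp only [Query.code, hq]; omega⟩

/-- Every natural number is the Gödel number of exactly one query. -/
noncomputable instance : Denumerable Query :=
  Denumerable.ofEquiv ℕ (Equiv.ofBijective Query.code ⟨Query.code_injective, Query.code_surjective⟩)

theorem Query.encode_eq_code (q : Query) : Encodable.encode q = q.code := rfl

noncomputable instance : Primcodable Query := Primcodable.ofDenumerable Query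

/-- The Gödel number of an MSO-FO formula. -/
noncomputable def MSOFO.code : MSOFO → ℕ
  | holdsAt q x => 8 * Nat.pair q.code x
  | lt x y => 8 * Nat.pair x y + 1
  | mem x X => 8 * Nat.pair x X + 2
  | neg φ => 8 * φ.code + 3
  | and φ₁ φ₂ => 8 * Nat.pair φ₁.code φ₂.code + 4
  | exPos x φ => 8 * Nat.pair x φ.code + 5
  | exSet X φ => 8 * Nat.pair X φ.code + 6
  | exData u φ => 8 * Nat.pair u φ.code + 7

theorem MSOFO.code_injective : Function.Injective MSOFO.code := by
  have key : ∀ {a b c d i : ℕ}, 8 * Nat.pair a b + i = 8 * Nat.pair c d + i → a = c ∧ b = d := by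
    intro a b c d i h
    exact Nat.pair_eq_pair.1 (by omega)
  intro a
  induction a with
  | holdsAt q x =>
    intro b h
    cases b with
    | holdsAt q' x' =>
      obtain ⟨h₁, rfl⟩ := key (i := 0) h
      rw [Query.code_injective h₁]
    | _ => simp only [MSOFO.code] at h; omega
  | lt x y =>
    intro b h
    cases b with
    | lt x' y' => obtain ⟨rfl, rfl⟩ := key h; rfl
    | _ => simp only [MSOFO.code] at h; omega
  | mem x y =>
    intro b h
    cases b with
    | mem x' y' => obtain ⟨rfl, rfl⟩ := key h; rfl
    | _ => simp only [MSOFO.code] at h; omega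
  | neg φ ih =>
    intro b h
    cases b with
    | neg φ' =>
      simp only [MSOFO.code] at h
      rw [ih (show φ.code = φ'.code by omega)]
    | _ => simp only [MSOFO.code] at h; omega
  | and φ₁ φ₂ ih₁ ih₂ =>
    intro b h
    cases b with
    | and φ₁' φ₂' =>
      obtain ⟨h₁, h₂⟩ := key h
      rw [ih₁ h₁, ih₂ h₂]
    | _ => simp only [MSOFO.code] at h; omega
  | exPos x φ ih =>
    intro b h
    cases b with
    | exPos x' φ' =>
      obtain ⟨rfl, h₂⟩ := key h
      rw [ih h₂]
    | _ => simp only [MSOFO.code] at h; omega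
  | exSet x φ ih =>
    intro b h
    cases b with
    | exSet x' φ' =>
      obtain ⟨rfl, h₂⟩ := key h
      rw [ih h₂]
    | _ => simp only [MSOFO.code] at h; omega
  | exData x φ ih =>
    intro b h
    cases b with
    | exData x' φ' =>
      obtain ⟨rfl, h₂⟩ := key h
      rw [ih h₂]
    | _ => simp only [MSOFO.code] at h; omega

theorem MSOFO.code_surjective : Function.Surjective MSOFO.code := by
  intro n
  induction n using Nat.strong_induction_on with
  | _ n ih =>
    obtain ⟨k, i, hi, rfl⟩ : ∃ k i, i < 8 ∧ n = 8 * k + i :=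
      ⟨n / 8, n % 8, Nat.mod_lt _ (by norm_num), by omega⟩
    have hl := Nat.unpair_left_le k
    have hr := Nat.unpair_right_le k
    have hp := Nat.pair_unpair k
    interval_cases i
    · obtain ⟨q, hq⟩ := Query.code_surjective k.unpair.1
      exact ⟨.holdsAt q k.unpair.2, by simp only [MSOFO.code, hq]; omega⟩
    · exact ⟨.lt k.unpair.1 k.unpair.2, by simp only [MSOFO.code]; omega⟩
    · exact ⟨.mem k.unpair.1 k.unpair.2, by simp only [MSOFO.code]; omega⟩
    · obtain ⟨q, hq⟩ := ih k (by omega)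
      exact ⟨.neg q, by simp only [MSOFO.code]; omega⟩
    · obtain ⟨q₁, h₁⟩ := ih k.unpair.1 (by omega)
      obtain ⟨q₂, h₂⟩ := ih k.unpair.2 (by omega)
      exact ⟨.and q₁ q₂, by simp only [MSOFO.code, h₁, h₂]; omega⟩
    · obtain ⟨q, hq⟩ := ih k.unpair.2 (by omega)
      exact ⟨.exPos k.unpair.1 q, by simp only [MSOFO.code, hq]; omega⟩
    · obtain ⟨q, hq⟩ := ih k.unpair.2 (by omega)
      exact ⟨.exSet k.unpair.1 q, by simp only [MSOFO.code, hq]; omega⟩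
    · obtain ⟨q, hq⟩ := ih k.unpair.2 (by omega)
      exact ⟨.exData k.unpair.1 q, by simp only [MSOFO.code, hq]; omega⟩

/-- Every natural number is the Gödel number of exactly one formula. -/
noncomputable instance : Denumerable MSOFO :=
  Denumerable.ofEquiv ℕ (Equiv.ofBijective MSOFO.code ⟨MSOFO.code_injective, MSOFO.code_surjective⟩)

theorem MSOFO.encode_eq_code (φ : MSOFO) : Encodable.encode φ = φ.code := rfl

noncomputable instance : Primcodable MSOFO := Primcodable.ofDenumerable MSOFO

/-- Actions are encoded as the tuples of their components. -/
def DMSAction.equivProd :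
    DMSAction ≃ List ℕ × List ℕ × Query × List (DBFact ℕ) × List (DBFact ℕ) where
  toFun α := (α.params, α.fresh, α.guard, α.del, α.add)
  invFun t := ⟨t.1, t.2.1, t.2.2.1, t.2.2.2.1, t.2.2.2.2⟩
  left_inv _ := rfl
  right_inv _ := rfl

noncomputable instance : Primcodable DMSAction := Primcodable.ofEquiv _ DMSAction.equivProd

/-- Database-manipulating systems are encoded as the tuples of their components. -/
def DMS.equivProd : DMS ≃ List ℕ × List ℕ × List DMSAction where
  toFun S := (S.schema, S.init, S.acts)
  invFun t := ⟨t.1, t.2.1, t.2.2⟩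
  left_inv _ := rfl
  right_inv _ := rfl

noncomputable instance : Primcodable DMS := Primcodable.ofEquiv _ DMS.equivProd

/-! ### Decision problems -/

/-- The decision problem "given an input `x` with `D x`, does `P x` hold?" is decidable: some
algorithm halts with the right answer on every input that satisfies `D`.  Nothing is asked of the
algorithm on the other inputs. -/
def DecidableOn {A : Type*} [Primcodable A] (D P : A → Prop) : Prop :=
  ∃ f : A →. Bool, Partrec f ∧ ∀ x, D x → ∃ b ∈ f x, (b = true ↔ P x)

/-- Model checking is decidable for the systems in the class `C`. -/
def ModelCheckingDecidable (Δ : Type*) (C : DMS → Prop) : Prop :=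
  DecidableOn
    (fun x : DMS × MSOFO => x.1.WF ∧ C x.1 ∧ x.2.Over x.1.schema ∧ x.2.IsSentence)
    (fun x => x.1.Models Δ x.2)

/-- Propositional reachability is decidable for the systems in the class `C`. -/
def PropReachDecidable (Δ : Type*) (C : DMS → Prop) : Prop :=
  DecidableOn
    (fun x : DMS × ℕ => x.1.WF ∧ C x.1 ∧ Schema.IsProp x.1.schema x.2)
    (fun x => x.1.PropReach Δ x.2)

/-- Propositional reachability along runs is decidable for the systems in the class `C`. -/
def RunReachDecidable (Δ : Type*) (C : DMS → Prop) : Prop :=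
  DecidableOn
    (fun x : DMS × ℕ => x.1.WF ∧ C x.1 ∧ Schema.IsProp x.1.schema x.2)
    (fun x => x.1.RunReach Δ x.2)

/-- `N` lists the arities of the non-nullary relations of the schema of `S`. -/
def DMS.HasArities (N : List ℕ) (S : DMS) : Prop := S.schema.filter (fun a => a ≠ 0) = N

/-- All guards of the actions of `S` are unions of conjunctive queries. -/
def DMS.UCQGuards (S : DMS) : Prop := ∀ α ∈ S.acts, α.guard.IsUCQ

/-! ### Nondeterministic counter programs -/

/-! The halting problem is reduced to propositional reachability through nondeterministic
two-counter machines. A system whose propositions store the control state can run such a machine as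
soon as its instances can store two counters with increment, decrement and zero test. The two
restricted classes differ only in how the counters are stored, and the unrestricted statement
follows from the class of systems with one binary relation.

Counter machines: a code halts on input `0` iff some bound `k` makes the primitive recursive
function `evaln` succeed. Since a program may guess `k`, only primitive recursive functions have to
be compiled into counter programs (`computes_of_primrec'`, with programs written as regular
expressions over counter operations). Coding a state of countably many counters as a product of
prime powers brings the number of counters down to two (`den_toTwo`): increment and decrement become
multiplication and exact division by a prime, and the zero test becomes non-divisibility. A regular
expression is then unfolded into a finite machine whose states are stacks of programs still to be
run (`reaches_edges_iff`). The input `n` is hard-wired by extra states that load it, so that every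
machine starts with empty counters.

Systems: `Simulates` collects what a representation of the counters has to satisfy, and
`Simulates.propReach_iff` derives that reachability of a state proposition is reachability in the
machine. Every system contains an idle action, so each finite execution extends to a run. Hence
reachability along runs is the same problem, and model checking the sentence `MSOFO.never p` is its
complement.

Two unary relations: a counter is the cardinality of a relation, and the zero test is a negated
existential query.

One binary relation with UCQ guards: negation is not available, so a counter is the length of a list
that ends in a known node, and it is zero iff the head points directly to this node. There are no
constants to name the heads and the end. Instead the relation also contains a small graph that every
guard asks for. By `IsCore.unique` this graph has essentially only one homomorphic image in the
instance, whatever the lists and the discarded cells look like, so a guard is forced to find the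
true heads. -/

/-- Operations on counters indexed by `ι`. -/
inductive CounterOp (ι : Type) : Type where
  | inc (i : ι) : CounterOp ι
  | dec (i : ι) : CounterOp ι
  | zero (i : ι) : CounterOp ι

/-- The relation between counter states that is defined by an operation.  A counter with value `0`
cannot be decremented, and `zero i` is the test whether the counter `i` has value `0`. -/
def CounterOp.Sem {ι : Type} : CounterOp ι → (ι →₀ ℕ) → (ι →₀ ℕ) → Prop
  | inc i, c, c' => c' = c + Finsupp.single i 1
  | dec i, c, c' => c = c' + Finsupp.single i 1
  | zero i, c, c' => c i = 0 ∧ c' = c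

/-- Nondeterministic counter programs: regular expressions over the operations. -/
abbrev CounterProg (ι : Type) := RegularExpression (CounterOp ι)

namespace CounterProg

open RegularExpression

variable {ι : Type}

/-- The input-output relation of a program. -/
def Den : CounterProg ι → (ι →₀ ℕ) → (ι →₀ ℕ) → Prop
  | .zero => fun _ _ => False
  | .epsilon => fun c c' => c' = c
  | .char o => o.Sem
  | .plus P Q => fun c c' => Den P c c' ∨ Den Q c c'
  | .comp P Q => Relation.Comp (Den P) (Den Q)
  | .star P => Relation.ReflTransGen (Den P)

variable {P Q : CounterProg ι} {c c' c₁ c₂ : ι →₀ ℕ}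

theorem den_zero : Den (0 : CounterProg ι) c c' ↔ False := Iff.rfl
theorem den_one : Den (1 : CounterProg ι) c c' ↔ c' = c := Iff.rfl
theorem den_char {o : CounterOp ι} : Den (char o) c c' ↔ o.Sem c c' := Iff.rfl
theorem den_add : Den (P + Q) c c' ↔ Den P c c' ∨ Den Q c c' := Iff.rfl
theorem den_mul : Den (P * Q) c c' ↔ ∃ d, Den P c d ∧ Den Q d c' := Iff.rfl
theorem den_star : Den (RegularExpression.star P) c c' ↔ Relation.ReflTransGen (Den P) c c' := Iff.rfl

theorem den_pow_succ (n : ℕ) : Den (P ^ (n + 1)) c c' ↔ ∃ d, Den (P ^ n) c d ∧ Den P d c' :=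
  Iff.rfl

/-- Started in `c`, the program has exactly one result, namely `c₁`. -/
def Runs (P : CounterProg ι) (c c₁ : ι →₀ ℕ) : Prop := ∀ c', Den P c c' ↔ c' = c₁

theorem Runs.mul (h₁ : Runs P c c₁) (h₂ : Runs Q c₁ c₂) : Runs (P * Q) c c₂ := by
  intro c'
  rw [den_mul]
  constructor
  · rintro ⟨d, hd, hd'⟩
    rw [h₁] at hd
    subst hd
    exact (h₂ _).1 hd'
  · rintro rfl
    exact ⟨c₁, (h₁ _).2 rfl, (h₂ _).2 rfl⟩

theorem runs_one : Runs (1 : CounterProg ι) c c := fun _ => Iff.rfl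

theorem runs_inc (i : ι) : Runs (char (.inc i)) c (c + Finsupp.single i 1) := fun _ => Iff.rfl

theorem runs_incs (i : ι) (k : ℕ) : Runs (char (.inc i) ^ k) c (c + Finsupp.single i k) := by
  induction k with
  | zero => simpa using! runs_one
  | succ k ih =>
    rw [Finsupp.single_add, ← add_assoc]
    exact ih.mul (runs_inc i)

/-- Decrements can fail, so there is no `Runs` statement for them; the condition is expressed by
addition to the result instead of truncated subtraction. -/
theorem den_decs (i : ι) (k : ℕ) :
    Den (char (.dec i) ^ k) c c' ↔ c = c' + Finsupp.single i k := by
  induction k generalizing c c' with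
  | zero => simpa [eq_comm] using! den_one (c := c) (c' := c')
  | succ k ih =>
    rw [den_pow_succ]
    simp only [ih, Finsupp.single_add, den_char, CounterOp.Sem]
    constructor
    · rintro ⟨d, rfl, rfl⟩
      rw [add_assoc, add_comm (Finsupp.single i 1)]
    · rintro rfl
      exact ⟨c' + Finsupp.single i 1, by rw [add_assoc, add_comm (Finsupp.single i 1)], rfl⟩

/-- Repeat "decrement `i`, then run `P`" until the counter `i` is `0`. -/
def while_ (i : ι) (P : CounterProg ι) : CounterProg ι :=
  RegularExpression.star (char (.dec i) * P) * char (.zero i)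

/-- Unfolding of the loop by one round: the iteration behind the star is split at its first step. -/
theorem den_while {i : ι} :
    Den (while_ i P) c c' ↔ (c i = 0 ∧ c' = c) ∨
      ∃ c₀ c₁, c = c₀ + Finsupp.single i 1 ∧ Den P c₀ c₁ ∧ Den (while_ i P) c₁ c' := by
  constructor
  · rintro ⟨d, hd, hd'⟩
    rw [den_star] at hd
    rcases Relation.ReflTransGen.cases_head hd with rfl | ⟨e, ⟨c₀, h₀, h₁⟩, he⟩
    · exact .inl hd'
    · exact .inr ⟨c₀, e, h₀, h₁, d, he, hd'⟩
  · rintro (⟨h, rfl⟩ | ⟨c₀, c₁, h₀, h₁, d, hd, hd'⟩)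
    · exact ⟨_, Relation.ReflTransGen.refl, h, rfl⟩
    · exact ⟨d, Relation.ReflTransGen.head ⟨c₀, h₀, h₁⟩ hd, hd'⟩

theorem runs_while_zero {i : ι} (h : c i = 0) : Runs (while_ i P) c c := by
  intro c'
  rw [den_while]
  constructor
  · rintro (⟨-, h'⟩ | ⟨c₀, c₁, rfl, -⟩)
    · exact h'
    · simp at h
  · exact fun h' => .inl ⟨h, h'⟩

theorem runs_while_succ {i : ι} (h₁ : Runs P c c₁) (h₂ : Runs (while_ i P) c₁ c₂) :
    Runs (while_ i P) (c + Finsupp.single i 1) c₂ := by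
  intro c'
  rw [den_while]
  constructor
  · rintro (⟨h, -⟩ | ⟨d₀, d₁, h, hP, hW⟩)
    · simp at h
    · rw [← add_right_cancel h, h₁] at hP
      subst hP
      exact (h₂ _).1 hW
  · rintro rfl
    exact .inr ⟨c, c₁, rfl, (h₁ _).2 rfl, (h₂ _).2 rfl⟩

/-- A loop whose body adds `d` to the counters, where `d i = 0`. -/
theorem runs_while_add {i : ι} {d : ι →₀ ℕ} (hP : ∀ c, Runs P c (c + d)) (hd : d i = 0)
    (hc : c i = 0) (n : ℕ) : Runs (while_ i P) (c + Finsupp.single i n) (c + n • d) := by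
  induction n generalizing c with
  | zero => simpa using runs_while_zero hc
  | succ n ih =>
    rw [Finsupp.single_add, ← add_assoc]
    refine runs_while_succ (hP _) ?_
    rw [add_right_comm, succ_nsmul', ← add_assoc]
    exact ih (by simp [hc, hd])

/-- Set the counter `i` to `0`. -/
def clear (i : ι) : CounterProg ι := while_ i 1

theorem runs_clear {i : ι} (hc : c i = 0) (n : ℕ) :
    Runs (clear i) (c + Finsupp.single i n) c := by
  simpa [clear] using runs_while_add (P := 1) (d := 0) (fun c => by simpa using runs_one) rfl hc n

/-- Move the value of the counter `i` to the counter `j`, multiplied by `k`. -/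
def move (i j : ι) (k : ℕ) : CounterProg ι := while_ i (char (.inc j) ^ k)

theorem runs_move {i j : ι} (hij : i ≠ j) (k : ℕ) (hc : c i = 0) (n : ℕ) :
    Runs (move i j k) (c + Finsupp.single i n) (c + Finsupp.single j (n * k)) := by
  have := runs_while_add (fun c => runs_incs (c := c) j k) (by simp [hij.symm]) hc n
  rwa [Finsupp.smul_single, smul_eq_mul] at this

end CounterProg

/-! ### Primitive recursive functions are computed by counter programs -/

namespace CounterProg

open RegularExpression

/-- For all distinct input and output registers below `base` there is a program that adds the value
of `f` at the input registers to the output register, provided that the registers from `base` on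
have value `0`. -/
def Computes {n : ℕ} (f : List.Vector ℕ n → ℕ) : Prop :=
  ∀ (ins : Fin n → ℕ) (out base : ℕ), (∀ i, ins i < base) → out < base → (∀ i, ins i ≠ out) →
    ∃ P : CounterProg ℕ, ∀ (c : ℕ →₀ ℕ) (v : List.Vector ℕ n), (∀ j, base ≤ j → c j = 0) →
      (∀ i, c (ins i) = v.get i) → Runs P c (c + Finsupp.single out (f v))

/-- Reading a counter destroys it. The loop therefore counts into `out` and into the scratch
register `base` at once, and the scratch register is moved back afterwards. -/
theorem computes_get {n : ℕ} (i : Fin n) : Computes fun v => v.get i := by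
  intro ins out base hins hout hne
  refine ⟨while_ (ins i) (char (.inc out) * char (.inc base)) * move base (ins i) 1, ?_⟩
  intro c v hc hv
  have h₁ := hins i
  have h₂ := hne i
  change Runs _ c (c + Finsupp.single out (v.get i))
  rw [← hv]
  generalize ins i = x at *
  -- The input register is split off, because the loop lemmas speak of a state with value `0` in the
  -- loop counter plus a multiple of its unit vector.
  let e := c.erase x
  have he : c = e + Finsupp.single x (c x) := (Finsupp.erase_add_single x c).symm
  have hex : e x = 0 := by simp [e]
  have heb : e base = 0 := by
    simp only [e]
    rw [Finsupp.erase_ne (by omega)]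
    exact hc _ le_rfl
  generalize c x = k at *
  clear_value e
  subst he
  have hw := runs_while_add (P := char (.inc out) * char (.inc base)) (i := x)
    (d := Finsupp.single out 1 + Finsupp.single base 1)
    (fun c => by
      rw [← add_assoc]
      exact (runs_inc out).mul (runs_inc base))
    (by
      have : base ≠ x := by omega
      simp [h₂.symm, this]) hex k
  refine hw.mul ?_
  have hm := runs_move (i := base) (j := x) (c := e + Finsupp.single out k) (by omega) 1
    (by
      have : out ≠ base := by omega
      simp [this, heb]) k
  convert hm using 1
  · rw [smul_add, Finsupp.smul_single, Finsupp.smul_single, smul_eq_mul, mul_one, add_assoc]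
  · rw [mul_one, add_right_comm]

theorem computes_zero : Computes (n := 0) fun _ => 0 := by
  intro ins out base _ _ _
  exact ⟨1, fun c v _ _ => by simpa using runs_one⟩

theorem computes_succ : Computes (n := 1) fun v => Nat.succ v.head := by
  intro ins out base hins hout hne
  obtain ⟨P, hP⟩ := computes_get (0 : Fin 1) ins out base hins hout hne
  refine ⟨P * char (.inc out), fun c v hc hv => ?_⟩
  have := (hP c v hc hv).mul (runs_inc out)
  rw [add_assoc, ← Finsupp.single_add] at this
  simpa only [List.Vector.get_zero] using this

/-- The values of the inner functions are placed in the registers `base + i`, one after the other.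
The scratch space of each program starts at `base + n`, out of reach of all these results. -/
theorem exists_runs_family {n m : ℕ} {g : Fin n → List.Vector ℕ m → ℕ} (hg : ∀ i, Computes (g i))
    (ins : Fin m → ℕ) (base : ℕ) (hins : ∀ i, ins i < base) (s : Finset (Fin n)) :
    ∃ P : CounterProg ℕ, ∀ (c : ℕ →₀ ℕ) (v : List.Vector ℕ m), (∀ j, base ≤ j → c j = 0) →
      (∀ i, c (ins i) = v.get i) →
      Runs P c (c + ∑ i ∈ s, Finsupp.single (base + i : ℕ) (g i v)) := by
  induction s using Finset.induction_on with
  | empty => exact ⟨1, fun c v _ _ => by simpa using runs_one⟩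
  | insert a s ha ih =>
    obtain ⟨P, hP⟩ := ih
    obtain ⟨Q, hQ⟩ := hg a ins (base + a) (base + n) (fun i => (hins i).trans_le (by omega))
      (by omega) (fun i => by have := hins i; omega)
    refine ⟨P * Q, fun c v hc hv => ?_⟩
    rw [Finset.sum_insert ha, add_comm (Finsupp.single _ _), ← add_assoc]
    refine (hP c v hc hv).mul (hQ _ v (fun j hj => ?_) (fun i => ?_))
    · rw [Finsupp.add_apply, hc j (by omega), Finsupp.finsetSum_apply, zero_add]
      refine Finset.sum_eq_zero fun i _ => ?_
      rw [Finsupp.single_apply, if_neg (by omega)]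
    · rw [Finsupp.add_apply, hv, Finsupp.finsetSum_apply, Finset.sum_eq_zero, add_zero]
      intro k _
      have := hins i
      rw [Finsupp.single_apply, if_neg (by omega)]

/-- Scratch registers have to be emptied again, since `Computes` allows no change outside the output
register. -/
theorem exists_clear_family {n : ℕ} (base : ℕ) (s : Finset (Fin n)) :
    ∃ P : CounterProg ℕ, ∀ (c : ℕ →₀ ℕ) (y : Fin n → ℕ), (∀ i : Fin n, c (base + i : ℕ) = 0) →
      Runs P (c + ∑ i ∈ s, Finsupp.single (base + i : ℕ) (y i)) c := by
  induction s using Finset.induction_on with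
  | empty => exact ⟨1, fun c y _ => by simpa using runs_one⟩
  | insert a s ha ih =>
    obtain ⟨P, hP⟩ := ih
    refine ⟨clear (base + a : ℕ) * P, fun c y hc => ?_⟩
    rw [Finset.sum_insert ha, add_comm (Finsupp.single _ _), ← add_assoc]
    refine (runs_clear ?_ _).mul (hP c y hc)
    rw [Finsupp.add_apply, hc, Finsupp.finsetSum_apply, zero_add]
    refine Finset.sum_eq_zero fun i hi => ?_
    rw [Finsupp.single_apply, if_neg]
    intro h
    exact ha (by rwa [Fin.ext (show (a : ℕ) = i by omega)])

theorem Computes.comp {m n : ℕ} {f : List.Vector ℕ n → ℕ} {g : Fin n → List.Vector ℕ m → ℕ}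
    (hf : Computes f) (hg : ∀ i, Computes (g i)) :
    Computes fun v => f (List.Vector.ofFn fun i => g i v) := by
  intro ins out base hins hout hne
  obtain ⟨P, hP⟩ := exists_runs_family hg ins base hins Finset.univ
  obtain ⟨Q, hQ⟩ := hf (fun i => base + i) out (base + n) (fun i => by omega) (by omega)
    (fun i => by omega)
  obtain ⟨R, hR⟩ := exists_clear_family (n := n) base Finset.univ
  refine ⟨P * Q * R, fun c v hc hv => ((hP c v hc hv).mul
    (hQ _ (List.Vector.ofFn fun i => g i v) (fun j hj => ?_) (fun i => ?_))).mul ?_⟩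
  · rw [Finsupp.add_apply, hc j (by omega), Finsupp.finsetSum_apply, zero_add]
    refine Finset.sum_eq_zero fun i _ => ?_
    rw [Finsupp.single_apply, if_neg (by omega)]
  · rw [Finsupp.add_apply, hc _ (by omega), Finsupp.finsetSum_apply, zero_add,
      Finset.sum_eq_single i, Finsupp.single_eq_same, List.Vector.get_ofFn]
    · intro k _ hk
      rw [Finsupp.single_apply, if_neg]
      intro h
      exact hk (Fin.ext (by omega))
    · simp
  · rw [add_right_comm]
    refine hR _ _ fun i => ?_
    rw [Finsupp.add_apply, hc _ (by omega), Finsupp.single_apply, if_neg (by omega), add_zero]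

/-- Register `base` holds the index of the recursion, `base + 1` the current value, `base + 2` the
next value and `base + 3` the number of rounds left. The last one is a copy of the recursion
argument, because the loop consumes its counter. -/
theorem Computes.prec {n : ℕ} {f : List.Vector ℕ n → ℕ} {g : List.Vector ℕ (n + 2) → ℕ}
    (hf : Computes f) (hg : Computes g) :
    Computes fun v : List.Vector ℕ (n + 1) =>
      v.head.rec (f v.tail) fun y IH => g (y ::ᵥ IH ::ᵥ v.tail) := by
  intro ins out base hins hout hne
  obtain ⟨F, hF⟩ := hf (fun i => ins i.succ) (base + 1) (base + 4)
    (fun i => (hins _).trans (by omega)) (by omega) (fun i => by have := hins i.succ; omega)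
  obtain ⟨C, hC⟩ := computes_get (0 : Fin (n + 1)) ins (base + 3) (base + 4)
    (fun i => (hins _).trans (by omega)) (by omega) (fun i => by have := hins i; omega)
  obtain ⟨G, hG⟩ := hg (Fin.cons base (Fin.cons (base + 1) fun i => ins i.succ)) (base + 2)
    (base + 4)
    (by
      refine Fin.cases (by simp) (Fin.cases (by simp) fun i => ?_)
      simpa using (hins i.succ).trans (by omega))
    (by omega)
    (by
      refine Fin.cases (by simp) (Fin.cases (by simp) fun i => ?_)
      have := hins i.succ
      simp only [Fin.cons_succ]
      omega)
  refine ⟨F * C * while_ (base + 3)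
    (G * clear (base + 1) * move (base + 2) (base + 1) 1 * char (.inc base)) *
      move (base + 1) out 1 * clear base, fun c v hc hv => ?_⟩
  have hcb : ∀ k, c (base + k) = 0 := fun k => hc _ (by omega)
  have hcb' : c base = 0 := hc _ le_rfl
  have hz : ∀ {i j : ℕ}, i ≠ j → ∀ k, Finsupp.single i k j = 0 := fun h k => by
    rw [Finsupp.single_apply, if_neg h]
  -- `r y` is the value after `y` rounds, and `st y k` is the state when `y` rounds are done and `k`
  -- are left.
  let r : ℕ → ℕ := fun x => Nat.rec (f v.tail) (fun y IH => g (y ::ᵥ IH ::ᵥ v.tail)) x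
  let st : ℕ → ℕ → (ℕ →₀ ℕ) := fun y k =>
    c + Finsupp.single base y + Finsupp.single (base + 1) (r y) + Finsupp.single (base + 3) k
  have body : ∀ y k, Runs (G * clear (base + 1) * move (base + 2) (base + 1) 1 *
      char (.inc base)) (st y k) (st (y + 1) k) := by
    intro y k
    have h₁ : Runs G (st y k) (st y k + Finsupp.single (base + 2) (r (y + 1))) := by
      refine hG _ (y ::ᵥ r y ::ᵥ v.tail) (fun j hj => ?_) (Fin.cases ?_ (Fin.cases ?_ fun i => ?_))
      · simp (disch := omega) [st, hz, hc j (by omega)]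
      · simp (disch := omega) [st, hz, hcb']
      · simp (disch := omega) [st, hz, hcb]
        rfl
      · have := hins i.succ
        simp (disch := omega) [st, hz, hv]
    have h₂ := runs_clear (i := base + 1) (c := c + Finsupp.single base y +
      Finsupp.single (base + 3) k + Finsupp.single (base + 2) (r (y + 1)))
      (by simp (disch := omega) [hz, hcb]) (r y)
    have h₃ := runs_move (i := base + 2) (j := base + 1) (c := c + Finsupp.single base y +
      Finsupp.single (base + 3) k) (by omega) 1
      (by simp (disch := omega) [hz, hcb]) (r (y + 1))
    have h₄ := runs_inc (c := c + Finsupp.single base y + Finsupp.single (base + 3) k +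
      Finsupp.single (base + 1) (r (y + 1) * 1)) base
    rw [show c + Finsupp.single base y + Finsupp.single (base + 3) k +
      Finsupp.single (base + 2) (r (y + 1)) + Finsupp.single (base + 1) (r y) =
      st y k + Finsupp.single (base + 2) (r (y + 1)) by simp only [st]; abel] at h₂
    convert ((h₁.mul h₂).mul h₃).mul h₄ using 1
    simp only [st, Finsupp.single_add, mul_one]
    abel
  have loop : ∀ k y, Runs (while_ (base + 3)
      (G * clear (base + 1) * move (base + 2) (base + 1) 1 * char (.inc base))) (st y k)
      (st (y + k) 0) := by
    intro k
    induction k with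
    | zero =>
      intro y
      exact runs_while_zero (by simp (disch := omega) [st, hz, hcb])
    | succ k ih =>
      intro y
      have := runs_while_succ (body y k) (ih (y + 1))
      rw [add_assoc y, add_comm 1 k] at this
      convert this using 1
      simp only [st, Finsupp.single_add, add_assoc]
  have h₁ := hF c v.tail (fun j hj => hc j (by omega)) (fun i => by rw [hv, List.Vector.get_tail_succ])
  have h₂ := hC (c + Finsupp.single (base + 1) (f v.tail)) v
    (fun j hj => by simp (disch := omega) [hz, hc j (by omega)])
    (fun i => by
      have := hins i
      simp (disch := omega) [hz, hv])
  have h₃ := loop (v.get 0) 0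
  have h₄ := runs_move (i := base + 1) (j := out) (c := c + Finsupp.single base (v.get 0)) (by omega)
    1 (by simp (disch := omega) [hz, hcb]) (r (v.get 0))
  have h₅ := runs_clear (i := base) (c := c + Finsupp.single out (r (v.get 0)))
    (by simp (disch := omega) [hz, hcb']) (v.get 0)
  have e₁ : c + Finsupp.single (base + 1) (f v.tail) + Finsupp.single (base + 3) (v.get 0) =
      st 0 (v.get 0) := by simp [st, r]
  have e₂ : st (0 + v.get 0) 0 = c + Finsupp.single base (v.get 0) +
      Finsupp.single (base + 1) (r (v.get 0)) := by simp [st]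
  rw [e₁] at h₂
  rw [e₂] at h₃
  rw [mul_one, add_right_comm c (Finsupp.single base _) (Finsupp.single out _)] at h₄
  simp only [← List.Vector.get_zero]
  exact (((h₁.mul h₂).mul h₃).mul h₄).mul h₅

theorem computes_of_primrec' {n : ℕ} {f : List.Vector ℕ n → ℕ} (hf : Nat.Primrec' f) :
    Computes f := by
  induction hf with
  | zero => exact computes_zero
  | succ => exact computes_succ
  | get i => exact computes_get i
  | comp g _ _ hf hg => exact hf.comp hg
  | prec _ _ hf hg => exact hf.prec hg

/-! ### A counter program with undecidable domain -/

theorem den_star_inc {ι : Type} {i : ι} {c c' : ι →₀ ℕ} :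
    Den (RegularExpression.star (char (.inc i))) c c' ↔ ∃ k, c' = c + Finsupp.single i k := by
  constructor
  · intro h
    induction h with
    | refl => exact ⟨0, by simp⟩
    | tail _ h ih =>
      obtain ⟨k, rfl⟩ := ih
      exact ⟨k + 1, by rw [Finsupp.single_add, ← add_assoc]; exact h⟩
  · rintro ⟨k, rfl⟩
    induction k with
    | zero => simpa using! Relation.ReflTransGen.refl
    | succ k ih =>
      rw [Finsupp.single_add, ← add_assoc]
      exact ih.tail rfl

/-- There is a program such that the set of the inputs on which it has a result is not
computable. -/
theorem exists_undecidable : ∃ P : CounterProg ℕ,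
    ¬ ComputablePred fun n : ℕ => ∃ c, Den P (Finsupp.single 0 n) c := by
  -- `K n k = 0` says that the code with number `n` halts on input `0` within the bound `k`.
  let K : ℕ → ℕ → ℕ := fun n k => bif
    (Nat.Partrec.Code.evaln k (Denumerable.ofNat Nat.Partrec.Code n) 0).isSome then 0 else 1
  have hK : Primrec₂ K :=
    Primrec.cond (Primrec.option_isSome.comp (Nat.Partrec.Code.primrec_evaln.comp
      ((Primrec.snd.pair ((Primrec.ofNat _).comp Primrec.fst)).pair (.const 0)))) (.const 0)
        (.const 1)
  obtain ⟨P, hP⟩ := computes_of_primrec' (Nat.Primrec'.prim_iff₂.2 hK) ![0, 1] 2 3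
    (by decide) (by decide) (by decide)
  have hrun : ∀ n k, Runs P (Finsupp.single 0 n + Finsupp.single 1 k)
      (Finsupp.single 0 n + Finsupp.single 1 k + Finsupp.single 2 (K n k)) := by
    intro n k
    refine hP _ (n ::ᵥ k ::ᵥ List.Vector.nil) (fun j hj => ?_) (fun i => ?_)
    · rw [Finsupp.add_apply, Finsupp.single_apply, Finsupp.single_apply, if_neg (by omega),
        if_neg (by omega), add_zero]
    · fin_cases i
      · simp
      · simp [List.Vector.get]
  -- The starred increment guesses a bound in register 1, `P` writes the value of `K` to register 2,
  -- and the final test accepts the guess iff this value is `0`.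
  refine ⟨RegularExpression.star (char (.inc 1)) * P * char (.zero 2), fun h => ?_⟩
  refine ComputablePred.halting_problem 0 (ComputablePred.computable_of_manyOneReducible ?_ h)
  refine ⟨Encodable.encode, Computable.encode, fun code => ?_⟩
  have h₁ : (Nat.Partrec.Code.eval code 0).Dom ↔ ∃ k, K (Encodable.encode code) k = 0 := by
    rw [Part.dom_iff_mem]
    simp only [Nat.Partrec.Code.evaln_complete, K, Denumerable.ofNat_encode]
    rw [exists_comm]
    refine exists_congr fun k => ?_
    cases Nat.Partrec.Code.evaln k code 0 <;> simp
  refine h₁.trans ?_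
  constructor
  · rintro ⟨k, hk⟩
    have := hrun (Encodable.encode code) k
    rw [hk] at this
    refine ⟨_, _, ⟨_, den_star_inc.2 ⟨k, rfl⟩, (this _).2 rfl⟩, ?_, rfl⟩
    simp
  · rintro ⟨c, d, ⟨e, he, hd⟩, hz, -⟩
    obtain ⟨k, rfl⟩ := den_star_inc.1 he
    rw [hrun] at hd
    subst hd
    exact ⟨k, by simpa using hz⟩

end CounterProg

/-! ### Two counters suffice -/

namespace CounterProg

open RegularExpression

/-- Multiply the counter `false` by `p`, with the help of the counter `true`. -/
def mulBy (p : ℕ) : CounterProg Bool := move false true p * move true false 1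

theorem runs_mulBy (p N : ℕ) :
    Runs (mulBy p) (Finsupp.single false N) (Finsupp.single false (N * p)) := by
  have h₁ := runs_move (i := false) (j := true) (c := 0) (by simp) p rfl N
  have h₂ := runs_move (i := true) (j := false) (c := 0) (by simp) 1 rfl (N * p)
  simp only [zero_add, mul_one] at h₁ h₂
  exact h₁.mul h₂

/-- Divide the counter `false` by `p`, with the help of the counter `true`. -/
def divBy (p : ℕ) : CounterProg Bool :=
  RegularExpression.star (char (.dec false) ^ p * char (.inc true)) * char (.zero false) *
    move true false 1

theorem eq_single_add_single (c : Bool →₀ ℕ) :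
    c = Finsupp.single false (c false) + Finsupp.single true (c true) := by
  ext b
  cases b <;> simp

/-- The equation is an invariant of the loop body, which trades `p` units of one counter for one
unit of the other. Conversely, every solution is reached by induction on the second counter. -/
theorem den_star_divBy {p N : ℕ} {c : Bool →₀ ℕ} :
    Den (RegularExpression.star (char (.dec false) ^ p * char (.inc true)))
      (Finsupp.single false N) c ↔ c false + p * c true = N := by
  rw [den_star]
  constructor
  · intro h
    induction h with
    | refl => simp
    | tail _ h ih =>
      obtain ⟨d, hd, rfl⟩ := h
      rw [den_decs] at hd
      subst hd
      simp only [Finsupp.add_apply, Finsupp.single_eq_same] at ih ⊢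
      rw [← ih]
      simp
      ring
  · rintro rfl
    obtain ⟨k, hk⟩ : ∃ k, c true = k := ⟨_, rfl⟩
    induction k generalizing c with
    | zero =>
      have e : c = Finsupp.single false (c false) := by
        nth_rewrite 1 [eq_single_add_single c]
        rw [hk, Finsupp.single_zero, add_zero]
      rw [hk, mul_zero, add_zero, ← e]
    | succ k ih =>
      have h := ih (c := Finsupp.single false (c false + p) + Finsupp.single true k) (by simp)
      have e : c false + p * c true = c false + p + p * k := by rw [hk]; ring
      have e' : (Finsupp.single false (c false + p) + Finsupp.single true k : Bool →₀ ℕ) false +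
          p * (Finsupp.single false (c false + p) + Finsupp.single true k : Bool →₀ ℕ) true =
          c false + p + p * k := by simp
      rw [e'] at h
      rw [e]
      refine h.tail ⟨Finsupp.single false (c false) + Finsupp.single true k, den_decs _ _ |>.2 ?_, ?_⟩
      · rw [Finsupp.single_add, add_right_comm]
      · change c = _
        nth_rewrite 1 [eq_single_add_single c]
        rw [hk, Finsupp.single_add, ← add_assoc]

/-- The loop may stop anywhere, but the zero test discards all outcomes except those without a
remainder. -/
theorem den_divBy {p N : ℕ} {c : Bool →₀ ℕ} :
    Den (divBy p) (Finsupp.single false N) c ↔ ∃ M, N = p * M ∧ c = Finsupp.single false M := by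
  have hm : ∀ M, Runs (move true false 1) (Finsupp.single true M) (Finsupp.single false M) := by
    intro M
    simpa using runs_move (i := true) (j := false) (c := 0) (by simp) 1 rfl M
  constructor
  · rintro ⟨_, ⟨d, hd, hz, he⟩, h⟩
    rw [he] at h
    rw [den_star_divBy, hz, zero_add] at hd
    rw [eq_single_add_single d, hz, Finsupp.single_zero, zero_add, hm] at h
    exact ⟨_, hd.symm, h⟩
  · rintro ⟨M, rfl, rfl⟩
    exact ⟨Finsupp.single true M, ⟨_, den_star_divBy.2 (by simp), by simp, rfl⟩, (hm M _).2 rfl⟩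

/-- Test that the counter `false` has a remainder in `1, ..., n` modulo `p`. -/
def remTest (p : ℕ) : ℕ → CounterProg Bool
  | 0 => 0
  | n + 1 => remTest p n + char (.dec false) ^ (n + 1) * divBy p * mulBy p *
      char (.inc false) ^ (n + 1)

/-- For each candidate `r`, the program subtracts `r` and divides by `p`, which succeeds only for
the right remainder; multiplying and adding back then restores the state, so that the test has no
side effect. -/
theorem den_remTest {p n N : ℕ} {c : Bool →₀ ℕ} :
    Den (remTest p n) (Finsupp.single false N) c ↔
      (∃ r M, 1 ≤ r ∧ r ≤ n ∧ N = M * p + r) ∧ c = Finsupp.single false N := by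
  induction n with
  | zero =>
    simp only [remTest, den_zero, false_iff]
    rintro ⟨⟨r, M, h₁, h₂, -⟩, -⟩
    omega
  | succ n ih =>
    have key : Den (char (.dec false) ^ (n + 1) * divBy p * mulBy p *
        char (.inc false) ^ (n + 1)) (Finsupp.single false N) c ↔
        (∃ M, N = M * p + (n + 1)) ∧ c = Finsupp.single false N := by
      constructor
      · rintro ⟨_, ⟨_, ⟨d, hd, h₁⟩, h₂⟩, h₃⟩
        rw [den_decs] at hd
        have hd' : d = Finsupp.single false (d false) := by
          have := DFunLike.congr_fun hd true
          simp only [Finsupp.add_apply, Finsupp.single_apply] at this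
          nth_rewrite 1 [eq_single_add_single d]
          rw [show d true = 0 by simpa using this.symm, Finsupp.single_zero, add_zero]
        rw [hd', den_divBy] at h₁
        obtain ⟨M, hM, rfl⟩ := h₁
        rw [runs_mulBy] at h₂
        subst h₂
        rw [runs_incs, ← Finsupp.single_add] at h₃
        have hN := DFunLike.congr_fun hd false
        simp only [Finsupp.add_apply, Finsupp.single_eq_same] at hN
        have hN' : N = M * p + (n + 1) := by rw [hN, hM, mul_comm]
        exact ⟨⟨M, hN'⟩, by rw [h₃, hN']⟩
      · rintro ⟨⟨M, rfl⟩, rfl⟩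
        refine ⟨_, ⟨_, ⟨_, (den_decs _ _).2 (Finsupp.single_add _ _ _),
          den_divBy.2 ⟨M, mul_comm _ _, rfl⟩⟩, (runs_mulBy p M _).2 rfl⟩, (runs_incs _ _ _).2 ?_⟩
        rw [Finsupp.single_add]
    rw [remTest, den_add, ih, key, ← or_and_right]
    refine and_congr_left fun _ => ⟨?_, ?_⟩
    · rintro (⟨r, M, h₁, h₂, h⟩ | ⟨M, h⟩)
      · exact ⟨r, M, h₁, by omega, h⟩
      · exact ⟨n + 1, M, by omega, le_rfl, h⟩
    · rintro ⟨r, M, h₁, h₂, h⟩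
      rcases Nat.lt_or_ge n r with h' | h'
      · obtain rfl : r = n + 1 := by omega
        exact .inr ⟨M, h⟩
      · exact .inl ⟨r, M, h₁, h', h⟩

theorem den_remTest_pred {p N : ℕ} (hp : 0 < p) {c : Bool →₀ ℕ} :
    Den (remTest p (p - 1)) (Finsupp.single false N) c ↔
      ¬ p ∣ N ∧ c = Finsupp.single false N := by
  rw [den_remTest]
  refine and_congr_left fun _ => ?_
  constructor
  · rintro ⟨r, M, h₁, h₂, rfl⟩ h
    have := Nat.le_of_dvd (by omega) ((Nat.dvd_add_right (dvd_mul_left p M)).1 h)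
    omega
  · intro h
    have h₁ := Nat.mod_lt N hp
    have h₂ : N % p ≠ 0 := fun h' => h (Nat.dvd_of_mod_eq_zero h')
    exact ⟨N % p, N / p, by omega, by omega, (Nat.div_add_mod' N p).symm⟩

/-- The number that encodes a state of countably many counters. -/
noncomputable def goedel (c : ℕ →₀ ℕ) : ℕ := c.prod fun i k => Nat.nth Nat.Prime i ^ k

theorem goedel_add (c d : ℕ →₀ ℕ) : goedel (c + d) = goedel c * goedel d :=
  Finsupp.prod_add_index' (by simp) fun _ _ _ => pow_add _ _ _

theorem goedel_single (i k : ℕ) : goedel (Finsupp.single i k) = Nat.nth Nat.Prime i ^ k :=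
  Finsupp.prod_single_index (by simp)

/-- This turns the zero test on a register into a divisibility test on the code, and shows that
exact division is possible precisely when a decrement is. -/
theorem nth_prime_dvd_goedel {c : ℕ →₀ ℕ} {i : ℕ} :
    Nat.nth Nat.Prime i ∣ goedel c ↔ c i ≠ 0 := by
  constructor
  · intro h h0
    obtain ⟨j, hj, hd⟩ := ((Nat.prime_nth_prime i).prime.dvd_finsetProd_iff _).1 h
    have := (Nat.prime_dvd_prime_iff_eq (Nat.prime_nth_prime i) (Nat.prime_nth_prime j)).1
      ((Nat.prime_nth_prime i).dvd_of_dvd_pow hd)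
    obtain rfl := Nat.nth_injective Nat.infinite_setOfPred_prime this
    exact Finsupp.mem_support_iff.1 hj h0
  · intro h
    obtain ⟨d, rfl⟩ : ∃ d, c = d + Finsupp.single i 1 :=
      ⟨c - Finsupp.single i 1, (tsub_add_cancel_of_le (by
        rw [Finsupp.single_le_iff]; omega)).symm⟩
    rw [goedel_add, goedel_single, pow_one]
    exact dvd_mul_left _ _

/-- The simulation of a program by a program with two counters, on the codes of the states. -/
noncomputable def toTwo : CounterProg ℕ → CounterProg Bool
  | .zero => 0
  | .epsilon => 1
  | .char (.inc i) => mulBy (Nat.nth Nat.Prime i)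
  | .char (.dec i) => divBy (Nat.nth Nat.Prime i)
  | .char (.zero i) => remTest (Nat.nth Nat.Prime i) (Nat.nth Nat.Prime i - 1)
  | .plus P Q => toTwo P + toTwo Q
  | .comp P Q => toTwo P * toTwo Q
  | .star P => RegularExpression.star (toTwo P)

/-- The statement includes that every result of the simulation is again a code with empty auxiliary
counter; the induction through products and stars needs this for the intermediate states. -/
theorem den_toTwo (P : CounterProg ℕ) (c : ℕ →₀ ℕ) (d : Bool →₀ ℕ) :
    Den (toTwo P) (Finsupp.single false (goedel c)) d ↔
      ∃ c', Den P c c' ∧ d = Finsupp.single false (goedel c') := by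
  induction P generalizing c d with
  | zero =>
    simp only [toTwo, den_zero, false_iff]
    rintro ⟨_, h, -⟩
    exact h
  | epsilon =>
    simp only [toTwo, den_one]
    exact ⟨fun h => ⟨c, rfl, h⟩, by rintro ⟨_, rfl, h⟩; exact h⟩
  | char o =>
    simp only [den_char]
    have hp := fun i => (Nat.prime_nth_prime i).pos
    cases o with
    | inc i =>
      simp only [toTwo, CounterOp.Sem, exists_eq_left, goedel_add, goedel_single, pow_one]
      exact runs_mulBy _ _ _
    | dec i =>
      simp only [toTwo, CounterOp.Sem, den_divBy]
      constructor
      · rintro ⟨M, hM, rfl⟩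
        have h : c i ≠ 0 := nth_prime_dvd_goedel.1 ⟨M, hM⟩
        obtain ⟨e, rfl⟩ : ∃ e, c = e + Finsupp.single i 1 :=
          ⟨c - Finsupp.single i 1, (tsub_add_cancel_of_le (by
            rw [Finsupp.single_le_iff]; omega)).symm⟩
        refine ⟨e, rfl, ?_⟩
        rw [goedel_add, goedel_single, pow_one, mul_comm] at hM
        rw [Nat.eq_of_mul_eq_mul_left (hp i) hM]
      · rintro ⟨e, rfl, rfl⟩
        exact ⟨goedel e, by rw [goedel_add, goedel_single, pow_one, mul_comm], rfl⟩
    | zero i =>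
      simp only [toTwo, CounterOp.Sem, den_remTest_pred (hp i), nth_prime_dvd_goedel, not_not]
      exact ⟨fun h => ⟨c, ⟨h.1, rfl⟩, h.2⟩, by rintro ⟨_, ⟨h, rfl⟩, h'⟩; exact ⟨h, h'⟩⟩
  | plus P Q ihP ihQ =>
    simp only [toTwo, plus_def, den_add, ihP, ihQ, or_and_right, exists_or]
  | comp P Q ihP ihQ =>
    simp only [toTwo, comp_def, den_mul, ihP]
    constructor
    · rintro ⟨_, ⟨e, he, rfl⟩, h⟩
      obtain ⟨c', h', rfl⟩ := (ihQ _ _).1 h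
      exact ⟨c', ⟨e, he, h'⟩, rfl⟩
    · rintro ⟨c', ⟨e, he, h'⟩, rfl⟩
      exact ⟨_, ⟨e, he, rfl⟩, (ihQ _ _).2 ⟨c', h', rfl⟩⟩
  | star P ih =>
    simp only [toTwo, den_star]
    constructor
    · intro h
      induction h with
      | refl => exact ⟨c, Relation.ReflTransGen.refl, rfl⟩
      | tail _ h ih' =>
        obtain ⟨e, he, rfl⟩ := ih'
        obtain ⟨c', h', rfl⟩ := (ih _ _).1 h
        exact ⟨c', he.tail h', rfl⟩
    · rintro ⟨c', h, rfl⟩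
      induction h with
      | refl => exact Relation.ReflTransGen.refl
      | tail _ h ih' => exact ih'.tail ((ih _ _).2 ⟨_, h, rfl⟩)

/-- There is a program with two counters such that the set of the inputs on which it has a result is
not computable. -/
theorem exists_undecidable_two : ∃ P : CounterProg Bool,
    ¬ ComputablePred fun n : ℕ => ∃ c, Den P (Finsupp.single false n) c := by
  obtain ⟨P, hP⟩ := exists_undecidable
  refine ⟨toTwo P, fun h => hP (ComputablePred.computable_of_manyOneReducible ?_ h)⟩
  have hpow : Primrec₂ fun a b : ℕ => a ^ b := Primrec₂.unpaired'.1 Nat.Primrec.pow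
  refine ⟨fun n => 2 ^ n, (hpow.comp (.const 2) .id).to_comp, fun n => ?_⟩
  -- The prime with index `0` is `2`, so the input `n` in register `0` has code `2 ^ n`.
  have := den_toTwo P (Finsupp.single 0 n)
  rw [goedel_single, Nat.nth_prime_zero_eq_two] at this
  simp only [this]
  exact ⟨fun ⟨c, h⟩ => ⟨_, c, h, rfl⟩, fun ⟨_, c, h, _⟩ => ⟨c, h⟩⟩

end CounterProg

/-! ### Nondeterministic counter machines -/

/-- The relation between counter states of an edge label: an operation, or no operation. -/
def CounterOp.OptSem {ι : Type} : Option (CounterOp ι) → (ι →₀ ℕ) → (ι →₀ ℕ) → Prop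
  | none, c, c' => c' = c
  | some o, c, c' => o.Sem c c'

/-- The edges of a counter machine with states in `Q`. -/
abbrev CounterEdge (ι Q : Type) := Q × Option (CounterOp ι) × Q

/-- The steps of the counter machine with the given edges. -/
def EdgeStep {ι Q : Type} (E : List (CounterEdge ι Q)) (s s' : Q × (ι →₀ ℕ)) : Prop :=
  ∃ o, (s.1, o, s'.1) ∈ E ∧ CounterOp.OptSem o s.2 s'.2

theorem EdgeStep.mono {ι Q : Type} {E E' : List (CounterEdge ι Q)} (h : E ⊆ E')
    {s s' : Q × (ι →₀ ℕ)} (hs : EdgeStep E s s') : EdgeStep E' s s' :=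
  hs.imp fun _ ho => ⟨h ho.1, ho.2⟩

theorem EdgeStep.of_none {ι Q : Type} {E : List (CounterEdge ι Q)} {q q' : Q}
    (h : (q, none, q') ∈ E) (c : ι →₀ ℕ) : EdgeStep E (q, c) (q', c) := ⟨none, h, rfl⟩

namespace CounterProg

open RegularExpression

variable {ι : Type}

/-- The edges of the machine that runs `P` and then the stack `k` of programs.  The states are stacks
of programs. -/
def edges : CounterProg ι → List (CounterProg ι) → List (CounterEdge ι (List (CounterProg ι)))
  | .zero, _ => []
  | .epsilon, k => [(.epsilon :: k, none, k)]
  | .char o, k => [(.char o :: k, some o, k)]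
  | .plus P Q, k => (.plus P Q :: k, none, P :: k) :: (.plus P Q :: k, none, Q :: k) ::
      (edges P k ++ edges Q k)
  | .comp P Q, k => (.comp P Q :: k, none, P :: Q :: k) :: (edges P (Q :: k) ++ edges Q k)
  | .star P, k => (.star P :: k, none, k) :: (.star P :: k, none, P :: .star P :: k) ::
      edges P (.star P :: k)

/-- The input-output relation of a stack of programs. -/
def DenStack : List (CounterProg ι) → (ι →₀ ℕ) → (ι →₀ ℕ) → Prop
  | [] => fun c c' => c' = c
  | P :: k => Relation.Comp (Den P) (DenStack k)

/-- The edge set is an arbitrary superset of `edges P k`, so that the induction hypotheses for the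
subprograms apply within the same machine. -/
theorem reaches_of_den {E : List (CounterEdge ι (List (CounterProg ι)))} (P : CounterProg ι)
    (k : List (CounterProg ι)) (hE : edges P k ⊆ E) {c c' : ι →₀ ℕ} (h : Den P c c') :
    Relation.ReflTransGen (EdgeStep E) (P :: k, c) (k, c') := by
  induction P generalizing k c c' with
  | zero => exact h.elim
  | epsilon => exact .single ⟨none, hE (by simp [edges]), h⟩
  | char o => exact .single ⟨some o, hE (by simp [edges]), h⟩
  | plus P Q ihP ihQ =>
    simp only [edges, List.cons_subset, List.append_subset] at hE
    rcases h with h | h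
    · exact .head (EdgeStep.of_none hE.1 _) (ihP k hE.2.2.1 h)
    · exact .head (EdgeStep.of_none hE.2.1 _) (ihQ k hE.2.2.2 h)
  | comp P Q ihP ihQ =>
    simp only [edges, List.cons_subset, List.append_subset] at hE
    obtain ⟨d, h₁, h₂⟩ := h
    exact .head (EdgeStep.of_none hE.1 _) ((ihP _ hE.2.1 h₁).trans (ihQ _ hE.2.2 h₂))
  | star P ih =>
    simp only [edges, List.cons_subset] at hE
    induction h using Relation.ReflTransGen.head_induction_on with
    | refl => exact .single ⟨none, hE.1, rfl⟩
    | head h _ ih' => exact .head (EdgeStep.of_none hE.2.1 _) ((ih _ hE.2.2 h).trans ih')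

/-- Each edge is sound backwards: what the remaining stack can achieve after the edge, the stack
before the edge can achieve as well. Applied from the end of a path to its start, this shows that
the machine does no more than the program. -/
theorem denStack_of_mem_edges (P : CounterProg ι) (k : List (CounterProg ι))
    {e : CounterEdge ι (List (CounterProg ι))} (he : e ∈ edges P k) {c d c' : ι →₀ ℕ}
    (h : CounterOp.OptSem e.2.1 c d) (hd : DenStack e.2.2 d c') : DenStack e.1 c c' := by
  induction P generalizing k with
  | zero => simp [edges] at he
  | epsilon =>
    obtain rfl : e = _ := by simpa only [edges, List.mem_singleton] using! he
    exact ⟨d, h, hd⟩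
  | char o =>
    obtain rfl : e = _ := by simpa only [edges, List.mem_singleton] using! he
    exact ⟨d, h, hd⟩
  | plus P Q ihP ihQ =>
    simp only [edges, List.mem_cons, List.mem_append] at he
    rcases he with rfl | rfl | he | he
    · obtain rfl : d = c := h
      obtain ⟨x, h₁, h₂⟩ := hd
      exact ⟨x, .inl h₁, h₂⟩
    · obtain rfl : d = c := h
      obtain ⟨x, h₁, h₂⟩ := hd
      exact ⟨x, .inr h₁, h₂⟩
    · exact ihP k he
    · exact ihQ k he
  | comp P Q ihP ihQ =>
    simp only [edges, List.mem_cons, List.mem_append] at he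
    rcases he with rfl | he | he
    · obtain rfl : d = c := h
      obtain ⟨x, h₁, y, h₂, h₃⟩ := hd
      exact ⟨y, ⟨x, h₁, h₂⟩, h₃⟩
    · exact ihP _ he
    · exact ihQ _ he
  | star P ih =>
    simp only [edges, List.mem_cons] at he
    rcases he with rfl | rfl | he
    · obtain rfl : d = c := h
      exact ⟨d, Relation.ReflTransGen.refl, hd⟩
    · obtain rfl : d = c := h
      obtain ⟨x, h₁, y, h₂, h₃⟩ := hd
      exact ⟨y, Relation.ReflTransGen.head h₁ h₂, h₃⟩
    · exact ih _ he

theorem reaches_edges_iff (P : CounterProg ι) (c c' : ι →₀ ℕ) :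
    Relation.ReflTransGen (EdgeStep (edges P [])) ([P], c) ([], c') ↔ Den P c c' := by
  constructor
  · intro h
    suffices ∀ s, Relation.ReflTransGen (EdgeStep (edges P [])) s ([], c') →
        DenStack s.1 s.2 c' by
      obtain ⟨d, h₁, rfl⟩ := this _ h
      exact h₁
    intro s hs
    induction hs using Relation.ReflTransGen.head_induction_on with
    | refl => rfl
    | head h _ ih =>
      obtain ⟨o, ho, hsem⟩ := h
      exact denStack_of_mem_edges P [] ho hsem ih
  · exact reaches_of_den P [] (List.Subset.refl _)

end CounterProg

/-- Counter machines with finitely many edges can be renamed so that their states are numbers. -/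
theorem exists_numbering {ι Q : Type} (E : List (CounterEdge ι Q)) (s t : Q) :
    ∃ (E' : List (CounterEdge ι ℕ)) (m s' t' : ℕ), (∀ e ∈ E', e.1 < m ∧ e.2.2 < m) ∧ s' < m ∧
      t' < m ∧ ∀ c c', Relation.ReflTransGen (EdgeStep E') (s', c) (t', c') ↔
        Relation.ReflTransGen (EdgeStep E) (s, c) (t, c') := by
  classical
  -- All states that matter; a state is renamed to its first position in this list, which is
  -- injective on members.
  let L : List Q := s :: t :: (E.map (fun e => e.1) ++ E.map fun e => e.2.2)
  have hL : ∀ e ∈ E, e.1 ∈ L ∧ e.2.2 ∈ L := by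
    intro e he
    simp only [L, List.mem_cons, List.mem_append, List.mem_map]
    exact ⟨.inr (.inr (.inl ⟨e, he, rfl⟩)), .inr (.inr (.inr ⟨e, he, rfl⟩))⟩
  have hs : s ∈ L := by simp [L]
  have ht : t ∈ L := by simp [L]
  have hinj : ∀ {a b : Q}, a ∈ L → L.idxOf a = L.idxOf b → a = b := fun ha h =>
    (List.idxOf_inj ha).1 h
  refine ⟨E.map fun e => (L.idxOf e.1, e.2.1, L.idxOf e.2.2), L.length, L.idxOf s, L.idxOf t, ?_,
    List.idxOf_lt_length_of_mem hs, List.idxOf_lt_length_of_mem ht, fun c c' => ⟨fun h => ?_,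
      fun h => ?_⟩⟩
  · simp only [List.mem_map]
    rintro _ ⟨e, he, rfl⟩
    exact ⟨List.idxOf_lt_length_of_mem (hL e he).1, List.idxOf_lt_length_of_mem (hL e he).2⟩
  · suffices ∀ x, Relation.ReflTransGen
        (EdgeStep (E.map fun e => (L.idxOf e.1, e.2.1, L.idxOf e.2.2))) (L.idxOf s, c) x →
        ∃ q ∈ L, x.1 = L.idxOf q ∧ Relation.ReflTransGen (EdgeStep E) (s, c) (q, x.2) by
      obtain ⟨q, hq, h₁, h₂⟩ := this _ h
      obtain rfl := hinj ht h₁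
      exact h₂
    intro x hx
    induction hx with
    | refl => exact ⟨s, hs, rfl, .refl⟩
    | tail _ h ih =>
      obtain ⟨q, hq, h₁, h₂⟩ := ih
      obtain ⟨o, ho, hsem⟩ := h
      obtain ⟨⟨a, o', b⟩, he, heq⟩ := List.mem_map.1 ho
      simp only [Prod.mk.injEq] at heq
      obtain ⟨ha, rfl, hb⟩ := heq
      obtain rfl := hinj (hL _ he).1 (ha.trans h₁)
      exact ⟨b, (hL _ he).2, hb.symm, h₂.tail ⟨o', he, hsem⟩⟩
  · have := h.lift (p := EdgeStep (E.map fun e => (L.idxOf e.1, e.2.1, L.idxOf e.2.2)))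
      (fun x => (L.idxOf x.1, x.2)) fun a b ⟨o, ho, hsem⟩ => ⟨o, List.mem_map.2 ⟨_, ho, rfl⟩, hsem⟩
    exact this

/-- Edges from the state `m + n` to the state `s` that increment the counter `false` exactly `n`
times. -/
def loadEdges (m s n : ℕ) : List (CounterEdge Bool ℕ) :=
  (m, none, s) :: (List.range n).map fun j => (m + j + 1, some (.inc false), m + j)

/-- The states from `m` on do not occur in `E`, so a path starting at `m + n` has to pass through
all the loading states before it enters the machine at `s`, and it never returns to them. -/
theorem reaches_loadEdges_iff {E : List (CounterEdge Bool ℕ)} {m s t n : ℕ}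
    (hE : ∀ e ∈ E, e.1 < m ∧ e.2.2 < m) (hs : s < m) (ht : t < m) (c : Bool →₀ ℕ) :
    Relation.ReflTransGen (EdgeStep (loadEdges m s n ++ E)) (m + n, 0) (t, c) ↔
      Relation.ReflTransGen (EdgeStep E) (s, Finsupp.single false n) (t, c) := by
  constructor
  · intro h
    -- Invariant: either loading is in progress, with `i` increments done and `j` to go, or the
    -- machine is already running.
    suffices ∀ x, Relation.ReflTransGen (EdgeStep (loadEdges m s n ++ E)) (m + n, 0) x →
        (∃ i j, i + j = n ∧ x = (m + j, Finsupp.single false i)) ∨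
          (x.1 < m ∧ Relation.ReflTransGen (EdgeStep E) (s, Finsupp.single false n) x) by
      rcases this _ h with ⟨i, j, -, h⟩ | h
      · simp only [Prod.mk.injEq] at h
        omega
      · exact h.2
    intro x hx
    induction hx with
    | refl => exact .inl ⟨0, n, by omega, by simp⟩
    | @tail x y _ h ih =>
      obtain ⟨o, ho, hsem⟩ := h
      obtain ⟨q, d⟩ := x
      obtain ⟨q', d'⟩ := y
      simp only [loadEdges, List.cons_append, List.mem_cons, List.mem_append, List.mem_map,
        List.mem_range, Prod.mk.injEq] at ho hsem
      rcases ih with ⟨i, j, hij, h⟩ | ⟨hlt, h⟩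
      · simp only [Prod.mk.injEq] at h
        obtain ⟨rfl, rfl⟩ := h
        rcases ho with ⟨h₁, rfl, rfl⟩ | ⟨k, hk, h₁, rfl, rfl⟩ | ho
        · obtain rfl : j = 0 := by omega
          obtain rfl : i = n := by omega
          obtain rfl : d' = _ := hsem
          exact .inr ⟨hs, .refl⟩
        · obtain rfl : j = k + 1 := by omega
          obtain rfl : d' = _ := hsem
          exact .inl ⟨i + 1, k, by omega, by rw [Finsupp.single_add]⟩
        · have := (hE _ ho).1
          simp at this
      · simp only at hlt
        rcases ho with ⟨h₁, rfl, rfl⟩ | ⟨k, hk, h₁, rfl, rfl⟩ | ho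
        · omega
        · omega
        · exact .inr ⟨(hE _ ho).2, h.tail ⟨o, ho, hsem⟩⟩
  · intro h
    have hload : ∀ j i, i + j = n → Relation.ReflTransGen (EdgeStep (loadEdges m s n ++ E))
        (m + j, Finsupp.single false i) (s, Finsupp.single false n) := by
      intro j
      induction j with
      | zero =>
        rintro i rfl
        exact .single ⟨none, by simp [loadEdges], rfl⟩
      | succ j ih =>
        intro i hi
        refine .head ⟨some (.inc false), ?_, ?_⟩ (ih (i + 1) (by omega))
        · simp only [loadEdges, List.cons_append, List.mem_cons, List.mem_append, List.mem_map,
            List.mem_range]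
          exact .inr (.inl ⟨j, by omega, rfl⟩)
        · exact Finsupp.single_add _ _ _
    have h₀ := hload n 0 (by omega)
    rw [Finsupp.single_zero] at h₀
    exact h₀.trans (h.lift id fun _ _ => EdgeStep.mono (List.subset_append_right _ _))

/-- There is a machine with two counters such that it is not computable for which input it reaches
its final state. -/
theorem exists_undecidable_machine : ∃ (E : List (CounterEdge Bool ℕ)) (m s t : ℕ),
    (∀ e ∈ E, e.1 < m ∧ e.2.2 < m) ∧ s < m ∧ t < m ∧ ¬ ComputablePred fun n : ℕ =>
      ∃ c, Relation.ReflTransGen (EdgeStep (loadEdges m s n ++ E)) (m + n, 0) (t, c) := by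
  obtain ⟨P, hP⟩ := CounterProg.exists_undecidable_two
  obtain ⟨E, m, s, t, hE, hs, ht, h⟩ := exists_numbering (CounterProg.edges P []) [P] []
  refine ⟨E, m, s, t, hE, hs, ht, ?_⟩
  simpa only [reaches_loadEdges_iff hE hs ht, h, CounterProg.reaches_edges_iff] using hP

/-! ### Steps of database-manipulating systems -/

/-- The configuration that results from an action. -/
def DMSAction.result {Δ : Type*} (α : DMSAction) (c : Config Δ) (σ : ℕ → Δ) : Config Δ :=
  ((c.1 \ substDB σ α.del) ∪ substDB σ α.add, c.2 ∪ {e | ∃ v ∈ α.fresh, σ v = e})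

theorem DMS.step_iff {Δ : Type*} {S : DMS} {c c' : Config Δ} :
    S.Step c c' ↔ ∃ α ∈ S.acts, ∃ σ, α.Instantiates c σ ∧ c' = α.result c σ := by
  simp only [DMS.Step, DMSAction.result, Prod.ext_iff]

/-- The action that changes nothing. -/
def DMSAction.idle : DMSAction := ⟨[], [], .tru, [], []⟩

theorem DMSAction.idle_instantiates {Δ : Type*} (c : Config Δ) (σ : ℕ → Δ) :
    DMSAction.idle.Instantiates c σ := by
  constructor <;> simp [idle, Query.Sat]

theorem DMSAction.idle_result {Δ : Type*} (c : Config Δ) (σ : ℕ → Δ) :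
    DMSAction.idle.result c σ = c := by
  ext <;> simp [idle, result, substDB]

theorem DMSAction.idle_wf (R : Schema) : DMSAction.idle.WF R := by
  constructor <;> simp [idle, Query.Over, Query.free]

namespace DMS

theorem IsRun.reflTransGen {Δ : Type*} {S : DMS} {ρ : ℕ → DB Δ} {H : ℕ → Set Δ}
    (h₀ : ρ 0 = S.initDB Δ) (hH : H 0 = ∅) (h : ∀ i, S.Step (ρ i, H i) (ρ (i + 1), H (i + 1)))
    (i : ℕ) : Relation.ReflTransGen S.Step (S.initDB Δ, ∅) (ρ i, H i) := by
  induction i with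
  | zero => rw [h₀, hH]
  | succ i ih => exact ih.tail (h i)

/-- If nothing has to happen, then every finite execution can be extended to a run. -/
theorem runReach_iff_propReach {Δ : Type*} [Nonempty Δ] {S : DMS} (hS : DMSAction.idle ∈ S.acts)
    (p : ℕ) : S.RunReach Δ p ↔ S.PropReach Δ p := by
  have hidle : ∀ c : Config Δ, S.Step c c := fun c => step_iff.2
    ⟨_, hS, fun _ => Classical.arbitrary Δ, DMSAction.idle_instantiates _ _,
      (DMSAction.idle_result _ _).symm⟩
  constructor
  · rintro ⟨ρ, ⟨H, h₀, hH, h⟩, i, hp⟩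
    exact ⟨_, IsRun.reflTransGen h₀ hH h i, hp⟩
  · rintro ⟨c, hc, hp⟩
    suffices ∃ (r : ℕ → Config Δ) (k : ℕ), r 0 = (S.initDB Δ, ∅) ∧
        (∀ i, S.Step (r i) (r (i + 1))) ∧ r k = c by
      obtain ⟨r, k, h₀, h, rfl⟩ := this
      exact ⟨fun i => (r i).1, ⟨fun i => (r i).2, by simp [h₀], by simp [h₀], h⟩, k, hp⟩
    clear hp
    induction hc with
    | refl => exact ⟨fun _ => _, 0, rfl, fun _ => hidle _, rfl⟩
    | @tail b c' _ hbc ih =>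
      obtain ⟨r, k, h₀, h, rfl⟩ := ih
      -- The run follows the given one up to position `k`, makes the new step, and idles from then
      -- on.
      refine ⟨fun i => if i ≤ k then r i else c', k + 1, by simp [h₀], fun i => ?_, by simp⟩
      rcases lt_trichotomy i k with hi | rfl | hi
      · simp only [if_pos hi.le, if_pos (Nat.succ_le_of_lt hi)]
        exact h i
      · simpa using hbc
      · simp only [if_neg (not_le.2 hi), if_neg (show ¬ i + 1 ≤ k by omega)]
        exact hidle _

end DMS

/-- The sentence that says that `p` never holds. -/
def MSOFO.never (p : ℕ) : MSOFO := .neg (.exPos 0 (.holdsAt (.rel p []) 0))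

theorem MSOFO.never_isSentence (p : ℕ) : (MSOFO.never p).IsSentence := by
  refine ⟨?_, ?_, ?_⟩ <;> simp [never, freePos, freeSet, freeData, Query.free]

theorem MSOFO.never_over {R : Schema} {p : ℕ} (hp : R.IsProp p) : (MSOFO.never p).Over R := by
  simpa [never, Over, Query.Over, DBFact.Over, Schema.IsProp] using hp

theorem DMS.models_never_iff {Δ : Type*} [Nonempty Δ] (S : DMS) (p : ℕ) :
    S.Models Δ (MSOFO.never p) ↔ ¬ S.RunReach Δ p := by
  simp only [Models, RunReach, MSOFO.never, MSOFO.Sat, Query.free, Query.Sat, DB.Holds,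
    Function.update_self, List.map_nil, List.toFinset_nil, Finset.notMem_empty, false_implies,
    implies_true, true_and, not_exists, not_and]
  exact ⟨fun h ρ hρ => h ρ hρ (fun _ => 0) (fun _ => ∅) (fun _ => Classical.arbitrary Δ),
    fun h ρ hρ _ _ _ => h ρ hρ⟩

/-! ### Reductions -/

/-- The algorithm may diverge outside `D`, but all values of `g` lie in `D`, so its composition with
`g` is total. -/
theorem DecidableOn.computablePred {A B : Type*} [Primcodable A] [Primcodable B] {D P : A → Prop}
    (h : DecidableOn D P) {g : B → A} (hg : Computable g) (hD : ∀ b, D (g b)) :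
    ComputablePred fun b => P (g b) := by
  obtain ⟨f, hf, h⟩ := h
  choose r hr hrP using fun b => h (g b) (hD b)
  refine ComputablePred.computable_iff.2 ⟨r, (Partrec.comp hf hg).of_eq fun b => ?_, ?_⟩
  · exact Part.eq_some_iff.2 (hr b)
  · funext b
    exact propext (hrP b).symm

theorem DecidableOn.mono {A : Type*} [Primcodable A] {D D' P : A → Prop} (h : DecidableOn D P)
    (hD : ∀ x, D' x → D x) : DecidableOn D' P :=
  h.imp fun _ hf => ⟨hf.1, fun x hx => hf.2 x (hD x hx)⟩

/-- The three decision problems are undecidable for a class of systems if some undecidable problem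
is computably reduced to propositional reachability for systems of the class that may idle. -/
theorem undecidable_of_reduction {Δ : Type*} [Nonempty Δ] {C : DMS → Prop} {S : ℕ → DMS} {p : ℕ}
    (hS : Computable S) (hwf : ∀ n, (S n).WF) (hC : ∀ n, C (S n))
    (hp : ∀ n, Schema.IsProp (S n).schema p) (hidle : ∀ n, DMSAction.idle ∈ (S n).acts)
    (h : ¬ ComputablePred fun n => (S n).PropReach Δ p) :
    ¬ ModelCheckingDecidable Δ C ∧ ¬ PropReachDecidable Δ C ∧ ¬ RunReachDecidable Δ C := by
  refine ⟨fun hd => h ?_, fun hd => h ?_, fun hd => h ?_⟩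
  · have := (hd.computablePred (g := fun n => (S n, MSOFO.never p))
      (hS.pair (.const _)) fun n =>
        ⟨hwf n, hC n, MSOFO.never_over (hp n), MSOFO.never_isSentence p⟩).not
    simpa only [DMS.models_never_iff, not_not, DMS.runReach_iff_propReach (hidle _)] using this
  · exact hd.computablePred (g := fun n => (S n, p)) (hS.pair (.const p))
      fun n => ⟨hwf n, hC n, hp n⟩
  · have := hd.computablePred (g := fun n => (S n, p)) (hS.pair (.const p))
      fun n => ⟨hwf n, hC n, hp n⟩
    simpa only [DMS.runReach_iff_propReach (hidle _)] using this

/-! ### Systems that run counter machines -/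

/-- The action that performs `α` and replaces the proposition `p` by the proposition `p'`. -/
def DMSAction.withState (α : DMSAction) (p p' : ℕ) : DMSAction :=
  ⟨α.params, α.fresh, .and (.rel p []) α.guard, (p, []) :: α.del, (p', []) :: α.add⟩

/-- The action does not add or delete propositions. -/
def DMSAction.NoProps (α : DMSAction) : Prop := ∀ f ∈ α.del ++ α.add, f.2 ≠ []

theorem DBFact.Over.append {X : Type*} {f : DBFact X} {R : Schema} (h : f.Over R) (R' : Schema) :
    f.Over (R ++ R') := by
  unfold DBFact.Over at *
  rw [List.getElem?_append_left (List.getElem?_eq_some_iff.1 h).1, h]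

theorem Query.Over.append {q : Query} {R : Schema} (h : q.Over R) (R' : Schema) :
    q.Over (R ++ R') := by
  induction q with
  | tru => trivial
  | rel r us => exact DBFact.Over.append h R'
  | eq u v => trivial
  | neg q ih => exact ih h
  | and q₁ q₂ ih₁ ih₂ => exact ⟨ih₁ h.1, ih₂ h.2⟩
  | ex u q ih => exact ih h

theorem DMSAction.WF.append {α : DMSAction} {R : Schema} (h : α.WF R) (R' : Schema) :
    α.WF (R ++ R') :=
  ⟨h.disjoint, h.guard_over.append R', h.params_eq, fun f hf => (h.del_over f hf).append R',
    h.del_vars, fun f hf => (h.add_over f hf).append R', h.add_vars, h.fresh_used⟩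

theorem DMSAction.WF.withState {α : DMSAction} {R : Schema} (h : α.WF R) {p p' : ℕ}
    (hp : R.IsProp p) (hp' : R.IsProp p') : (α.withState p p').WF R := by
  refine ⟨h.disjoint, ⟨hp, h.guard_over⟩, fun u => ?_, ?_, ?_, ?_, ?_, fun v hv => ?_⟩
  · simpa [DMSAction.withState, Query.free] using h.params_eq u
  · simpa [DMSAction.withState] using ⟨hp, fun a b => h.del_over (a, b)⟩
  · simpa [DMSAction.withState] using fun a b => h.del_vars (a, b)
  · simpa [DMSAction.withState] using ⟨hp', fun a b => h.add_over (a, b)⟩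
  · simpa [DMSAction.withState] using fun a b => h.add_vars (a, b)
  · obtain ⟨f, hf, hv⟩ := h.fresh_used v hv
    exact ⟨f, List.mem_cons_of_mem _ hf, hv⟩

section Step

variable {Δ : Type*} {α : DMSAction} {D : DB Δ} {H : Set Δ} {σ : ℕ → Δ} {p p' q : ℕ}

/-- Exactly one proposition holds, so the added conjunct of the guard compares the control states.
-/
theorem DMSAction.withState_instantiates_iff (hD : ∀ f ∈ D, f.2 ≠ []) :
    (α.withState p p').Instantiates (insert (q, []) D, H) σ ↔
      p = q ∧ α.Instantiates (insert (q, []) D, H) σ := by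
  have key : (p, ([] : List Δ)) ∈ insert (q, []) D ↔ p = q := by
    rw [Set.mem_insert_iff]
    constructor
    · rintro (h | h)
      · exact (Prod.mk.inj h).1
      · exact absurd rfl (hD _ h)
    · rintro rfl
      exact .inl rfl
  constructor
  · intro h
    exact ⟨key.1 h.sat.1, h.active, h.hist_fresh, h.inj, h.sat.2⟩
  · rintro ⟨hpq, h⟩
    exact ⟨h.active, h.hist_fresh, h.inj, key.2 hpq, h.sat⟩

theorem mem_substDB_noProps {F : List (DBFact ℕ)} (hF : ∀ f ∈ F, f.2 ≠ []) :
    ∀ f ∈ substDB σ F, f.2 ≠ [] := by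
  rintro _ ⟨g, hg, rfl⟩ h
  exact hF g hg (List.map_eq_nil_iff.1 h)

theorem substDB_cons (σ : ℕ → Δ) (f : DBFact ℕ) (F : List (DBFact ℕ)) :
    substDB σ (f :: F) = insert (f.1, f.2.map σ) (substDB σ F) := by
  ext g
  simp only [substDB, List.mem_cons, exists_eq_or_imp, Set.mem_insert_iff, Set.mem_ofPred_eq]

/-- The control state and the data do not interfere: `D` and `α` are free of propositions. For `p =
p'` the proposition survives because additions take effect after deletions. -/
theorem DMSAction.withState_result (hα : α.NoProps) (hD : ∀ f ∈ D, f.2 ≠ []) :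
    (α.withState p p').result (insert (p, []) D, H) σ =
      (insert (p', []) (α.result (D, H) σ).1, (α.result (D, H) σ).2) := by
  have hdel := mem_substDB_noProps (σ := σ) fun f hf => hα f (List.mem_append_left _ hf)
  simp only [result, withState, substDB_cons, List.map_nil, Prod.mk.injEq, and_true]
  ext f
  simp only [Set.mem_union, Set.mem_sdiff, Set.mem_insert_iff]
  have h₁ : f ∈ D → f ≠ (p, []) := fun h e => hD f h (by rw [e])
  tauto

end Step

/-- The actions of a counter machine with initial state `s`.  The proposition `K` stands for the
situation before the initialization, and `K + 1 + q` stands for the state `q`. -/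
def counterActs (boot : DMSAction) (op : Option (CounterOp Bool) → DMSAction) (K s : ℕ)
    (E : List (CounterEdge Bool ℕ)) : List DMSAction :=
  .idle :: boot.withState K (K + 1 + s) ::
    E.map fun e => (op e.2.1).withState (K + 1 + e.1) (K + 1 + e.2.2)

/-- The system that runs a counter machine with the initial state `s` and states below `m`.  The
relations of positive arity are given by `N`. -/
def counterDMS (N : List ℕ) (boot : DMSAction) (op : Option (CounterOp Bool) → DMSAction)
    (m s : ℕ) (E : List (CounterEdge Bool ℕ)) : DMS :=
  ⟨N ++ (List.range (1 + m)).map fun _ => 0, [N.length], counterActs boot op N.length s E⟩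

/-- The actions `boot` and `op` represent counters by configurations according to the
relation `Rel`. -/
structure Simulates {Δ : Type*} (boot : DMSAction) (op : CounterOp Bool → DMSAction)
    (Rel : Config Δ → (Bool →₀ ℕ) → Prop) : Prop where
  boot_noProps : boot.NoProps
  op_noProps : ∀ o, (op o).NoProps
  rel_noProps : ∀ c n, Rel c n → ∀ f ∈ c.1, f.2 ≠ []
  boot_exists : ∀ p, ∃ σ : ℕ → Δ, boot.Instantiates ({(p, [])}, ∅) σ
  boot_rel : ∀ p (σ : ℕ → Δ), boot.Instantiates ({(p, [])}, ∅) σ → Rel (boot.result (∅, ∅) σ) 0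
  op_exists : ∀ o c n n' p, Rel c n → o.Sem n n' →
    ∃ σ, (op o).Instantiates (insert (p, []) c.1, c.2) σ ∧ Rel ((op o).result c σ) n'
  op_sound : ∀ o c n p σ, Rel c n → (op o).Instantiates (insert (p, []) c.1, c.2) σ →
    ∃ n', o.Sem n n' ∧ Rel ((op o).result c σ) n'

/-- The action for an edge label. -/
def optAction (op : CounterOp Bool → DMSAction) (o : Option (CounterOp Bool)) : DMSAction :=
  o.elim .idle op

/-- The reachable configurations are the initial one and those that consist of one state proposition
and a representation of counters reached by the machine in this state. Soundness of the actions
preserves this description, and their existence part lifts machine paths to executions. -/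
theorem Simulates.propReach_iff {Δ : Type*} [Nonempty Δ] {boot : DMSAction}
    {op : CounterOp Bool → DMSAction} {Rel : Config Δ → (Bool →₀ ℕ) → Prop}
    (h : Simulates boot op Rel) (N : List ℕ) (m s t : ℕ) (E : List (CounterEdge Bool ℕ)) :
    (counterDMS N boot (optAction op) m s E).PropReach Δ (N.length + 1 + t) ↔
      ∃ n, Relation.ReflTransGen (EdgeStep E) (s, 0) (t, n) := by
  set S := counterDMS N boot (optAction op) m s E
  set K := N.length
  have hnp : ∀ o, (optAction op o).NoProps := by
    rintro (_ | o)
    · simp [optAction, DMSAction.NoProps, DMSAction.idle]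
    · exact h.op_noProps o
  have hex : ∀ o c n n' p, Rel c n → CounterOp.OptSem o n n' →
      ∃ σ, (optAction op o).Instantiates (insert (p, []) c.1, c.2) σ ∧
        Rel ((optAction op o).result c σ) n' := by
    rintro (_ | o) c n n' p hR hs
    · obtain rfl : n' = n := hs
      refine ⟨fun _ => Classical.arbitrary Δ, DMSAction.idle_instantiates _ _, ?_⟩
      exact (DMSAction.idle_result c _).symm ▸ hR
    · exact h.op_exists o c n n' p hR hs
  have hsound : ∀ o c n p σ, Rel c n →
      (optAction op o).Instantiates (insert (p, []) c.1, c.2) σ →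
      ∃ n', CounterOp.OptSem o n n' ∧ Rel ((optAction op o).result c σ) n' := by
    rintro (_ | o) c n p σ hR hs
    · exact ⟨n, rfl, (DMSAction.idle_result c σ).symm ▸ hR⟩
    · exact h.op_sound o c n p σ hR hs
  have hinit : ((S.initDB Δ, ∅) : Config Δ) = (insert (K, []) ∅, ∅) := by
    simp [S, DMS.initDB, counterDMS, K]
  have hboot : ∀ σ, boot.Instantiates (({(K, [])}, ∅) : Config Δ) σ ↔
      (boot.withState K (K + 1 + s)).Instantiates (insert (K, []) ∅, ∅) σ := fun σ => by
    rw [DMSAction.withState_instantiates_iff (by simp)]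
    simp
  constructor
  · rintro ⟨c, hc, hp⟩
    suffices ∀ c : Config Δ, Relation.ReflTransGen S.Step (S.initDB Δ, ∅) c →
        c = (insert (K, []) ∅, ∅) ∨ ∃ q n d, c = (insert (K + 1 + q, []) d.1, d.2) ∧ Rel d n ∧
          Relation.ReflTransGen (EdgeStep E) (s, 0) (q, n) by
      rcases this c hc with rfl | ⟨q, n, d, rfl, hR, hr⟩
      · simp only [DB.Holds, Set.mem_insert_iff, Prod.mk.injEq, Set.mem_empty_iff_false, and_true,
          or_false] at hp
        omega
      · simp only [DB.Holds, Set.mem_insert_iff, Prod.mk.injEq, and_true] at hp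
        rcases hp with hp | hp
        · obtain rfl : t = q := by omega
          exact ⟨n, hr⟩
        · exact absurd rfl (h.rel_noProps _ _ hR _ hp)
    intro c hc
    induction hc with
    | refl => exact .inl hinit
    | @tail b c _ hbc ih =>
      obtain ⟨α, hα, σ, hσ, rfl⟩ := DMS.step_iff.1 hbc
      simp only [S, counterDMS, counterActs, List.mem_cons, List.mem_map] at hα
      rcases hα with rfl | rfl | ⟨e, he, rfl⟩
      · rwa [DMSAction.idle_result]
      · rcases ih with rfl | ⟨q, n, d, rfl, hR, hr⟩
        · refine .inr ⟨s, 0, boot.result (∅, ∅) σ, ?_, h.boot_rel _ _ ((hboot σ).2 hσ), .refl⟩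
          exact DMSAction.withState_result h.boot_noProps (by simp)
        -- Booting consumes the proposition `K`, so it cannot happen twice.
        · rw [DMSAction.withState_instantiates_iff (h.rel_noProps _ _ hR)] at hσ
          omega
      · rcases ih with rfl | ⟨q, n, d, rfl, hR, hr⟩
        · rw [DMSAction.withState_instantiates_iff (by simp)] at hσ
          omega
        · rw [DMSAction.withState_instantiates_iff (h.rel_noProps _ _ hR)] at hσ
          obtain ⟨hq, hσ⟩ := hσ
          obtain rfl : e.1 = q := by omega
          obtain ⟨n', hs, hR'⟩ := hsound _ d n _ σ hR hσ
          exact .inr ⟨e.2.2, n', _, DMSAction.withState_result (hnp _) (h.rel_noProps _ _ hR), hR',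
            hr.tail ⟨_, he, hs⟩⟩
  · rintro ⟨n, hr⟩
    suffices ∀ x, Relation.ReflTransGen (EdgeStep E) (s, 0) x → ∃ d, Rel d x.2 ∧
        Relation.ReflTransGen S.Step (S.initDB Δ, ∅) (insert (K + 1 + x.1, []) d.1, d.2) by
      obtain ⟨d, -, hd⟩ := this _ hr
      exact ⟨_, hd, .inl rfl⟩
    intro x hx
    induction hx with
    | refl =>
      obtain ⟨σ, hσ⟩ := h.boot_exists K
      refine ⟨_, h.boot_rel _ _ hσ, .single (DMS.step_iff.2
        ⟨boot.withState K (K + 1 + s), by simp [S, counterDMS, counterActs, K], σ, ?_, ?_⟩)⟩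
      · rw [hinit]
        exact (hboot σ).1 hσ
      · rw [hinit]
        exact (DMSAction.withState_result h.boot_noProps (by simp)).symm
    | @tail x y _ hxy ih =>
      obtain ⟨d, hR, hd⟩ := ih
      obtain ⟨o, ho, hs⟩ := hxy
      obtain ⟨σ, hσ, hR'⟩ := hex o d _ _ (K + 1 + x.1) hR hs
      refine ⟨_, hR', hd.tail (DMS.step_iff.2
        ⟨(optAction op o).withState (K + 1 + x.1) (K + 1 + y.1), ?_, σ, ?_, ?_⟩)⟩
      · simp only [S, counterDMS, counterActs, List.mem_cons, List.mem_map]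
        exact .inr (.inr ⟨_, ho, rfl⟩)
      · exact (DMSAction.withState_instantiates_iff (h.rel_noProps _ _ hR)).2 ⟨rfl, hσ⟩
      · exact (DMSAction.withState_result (hnp _) (h.rel_noProps _ _ hR)).symm

theorem counterDMS_isProp (N : List ℕ) (boot : DMSAction)
    (op : Option (CounterOp Bool) → DMSAction) {m q : ℕ} (s : ℕ) (E : List (CounterEdge Bool ℕ))
    (hq : q < 1 + m) : Schema.IsProp (counterDMS N boot op m s E).schema (N.length + q) := by
  simp [Schema.IsProp, counterDMS, hq]

theorem counterDMS_wf {N : List ℕ} {boot : DMSAction} {op : CounterOp Bool → DMSAction} {m s : ℕ}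
    {E : List (CounterEdge Bool ℕ)} (hboot : boot.WF N) (hop : ∀ o, (op o).WF N) (hs : s < m)
    (hE : ∀ e ∈ E, e.1 < m ∧ e.2.2 < m) : (counterDMS N boot (optAction op) m s E).WF := by
  have hp := fun {q} => counterDMS_isProp N boot (optAction op) (m := m) (q := q) s E
  have hopt : ∀ o, (optAction op o).WF N := by
    rintro (_ | o)
    · exact DMSAction.idle_wf N
    · exact hop o
  constructor
  · intro p hp'
    obtain rfl : p = N.length := by simpa [counterDMS] using hp'
    exact hp (q := 0) (by omega)
  · intro α hα
    simp only [counterDMS, counterActs, List.mem_cons, List.mem_map] at hα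
    rcases hα with rfl | rfl | ⟨e, he, rfl⟩
    · exact DMSAction.idle_wf _
    · refine (hboot.append _).withState (hp (q := 0) (by omega)) ?_
      rw [add_assoc]
      exact hp (by omega)
    · have := hE e he
      refine ((hopt _).append _).withState ?_ ?_ <;> rw [add_assoc] <;> exact hp (by omega)

theorem counterDMS_hasArities {N : List ℕ} (hN : 0 ∉ N) (boot : DMSAction)
    (op : Option (CounterOp Bool) → DMSAction) (m s : ℕ) (E : List (CounterEdge Bool ℕ)) :
    (counterDMS N boot op m s E).HasArities N := by
  rw [DMS.HasArities, counterDMS, List.filter_append, List.filter_eq_self.2, List.filter_eq_nil_iff.2,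
    List.append_nil]
  · simp
  · intro a ha
    simpa using fun h : a = 0 => hN (h ▸ ha)

theorem counterDMS_ucqGuards {N : List ℕ} {boot : DMSAction} {op : CounterOp Bool → DMSAction}
    (hboot : boot.guard.IsConj) (hop : ∀ o, (op o).guard.IsConj) (m s : ℕ)
    (E : List (CounterEdge Bool ℕ)) : (counterDMS N boot (optAction op) m s E).UCQGuards := by
  intro α hα
  have hopt : ∀ o, (optAction op o).guard.IsConj := by
    rintro (_ | o)
    · exact .tru
    · exact hop o
  simp only [counterDMS, counterActs, List.mem_cons, List.mem_map] at hα
  rcases hα with rfl | rfl | ⟨e, he, rfl⟩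
  · exact .cq (.conj .tru)
  · exact .cq (.conj (.and (.rel _ _) hboot))
  · exact .cq (.conj (.and (.rel _ _) (hopt _)))

/-! ### Computability of the reduction -/

/-- The coding of queries is given by Gödel numbers, so a constructor is primitive recursive because
it is arithmetic on codes. -/
theorem Query.primrec₂_and : Primrec₂ Query.and := by
  refine Primrec₂.encode_iff.1 ?_
  have e : ∀ q₁ q₂ : Query, Encodable.encode (Query.and q₁ q₂) =
      5 * Nat.pair (Encodable.encode q₁) (Encodable.encode q₂) + 4 := fun _ _ => rfl
  simp only [e]
  exact Primrec.nat_add.comp (Primrec.nat_mul.comp (.const 5) (Primrec₂.natPair.comp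
    (Primrec.encode.comp .fst) (Primrec.encode.comp .snd))) (.const 4)

theorem Query.primrec_prop : Primrec fun p => Query.rel p [] := by
  refine Primrec.encode_iff.1 ?_
  have e : ∀ p : ℕ, Encodable.encode (Query.rel p []) =
      5 * Encodable.encode (p, ([] : List ℕ)) + 1 := fun _ => rfl
  simp only [e]
  exact Primrec.nat_add.comp (Primrec.nat_mul.comp (.const 5)
    (Primrec.encode.comp (Primrec.pair .id (.const [])))) (.const 1)

theorem DMSAction.primrec₂_withState (α : DMSAction) : Primrec₂ α.withState := by
  have hcons : ∀ (l : List (DBFact ℕ)) {f : ℕ × ℕ → ℕ}, Primrec f →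
      Primrec fun x => ((f x, []) : DBFact ℕ) :: l := fun l f hf =>
    Primrec.list_cons.comp (hf.pair (.const [])) (.const l)
  have h : Primrec fun x : ℕ × ℕ => DMSAction.equivProd.symm (α.params, α.fresh,
      Query.and (.rel x.1 []) α.guard, ((x.1, []) : DBFact ℕ) :: α.del, (x.2, []) :: α.add) :=
    Primrec.of_equiv_symm.comp ((Primrec.const _).pair ((Primrec.const _).pair
      ((Query.primrec₂_and.comp (Query.primrec_prop.comp .fst) (.const _)).pair
        ((hcons _ .fst).pair (hcons _ .snd)))))
  exact h

/-- Only the number of propositions, the initial state and the loading edges depend on `n`. The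
machine has `m + n + 1` states, since loading uses the states `m, ..., m + n`. -/
theorem computable_counterDMS (N : List ℕ) (boot : DMSAction)
    (op : Option (CounterOp Bool) → DMSAction) (m s : ℕ) (E : List (CounterEdge Bool ℕ)) :
    Computable fun n => counterDMS N boot op (m + n + 1) (m + n) (loadEdges m s n ++ E) := by
  have hadd : ∀ k, Primrec fun n => k + n := fun k => Primrec.nat_add.comp (.const k) .id
  have hacts : Primrec fun n => counterActs boot op N.length (m + n) (loadEdges m s n ++ E) := by
    simp only [counterActs, loadEdges, List.cons_append, List.map_cons, List.map_append,
      List.map_map, Function.comp_def]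
    refine Primrec.list_cons.comp (.const _) (Primrec.list_cons.comp ?_ (Primrec.list_cons.comp
      (.const _) (Primrec.list_append.comp (Primrec.list_map Primrec.list_range ?_) (.const _))))
    · exact (DMSAction.primrec₂_withState boot).comp (.const _) ((hadd _).comp (hadd _))
    · exact ((DMSAction.primrec₂_withState (op (some (.inc false)))).comp
        ((hadd _).comp (Primrec.succ.comp (hadd m))) ((hadd _).comp (hadd m))).comp Primrec.snd
  have h : Primrec fun n => DMS.equivProd.symm (N ++ (List.range (1 + (m + n + 1))).map fun _ => 0,
      [N.length], counterActs boot op N.length (m + n) (loadEdges m s n ++ E)) :=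
    Primrec.of_equiv_symm.comp ((Primrec.list_append.comp (.const _) (Primrec.list_map
      (Primrec.list_range.comp ((hadd 1).comp (Primrec.succ.comp (hadd m)))) (.const 0))).pair
        ((Primrec.const _).pair hacts))
  exact h.to_comp

/-- The three decision problems are undecidable for a class of systems that contains the systems
that run counter machines by means of some simulation. -/
theorem Simulates.undecidable {Δ : Type*} [Nonempty Δ] {boot : DMSAction}
    {op : CounterOp Bool → DMSAction} {Rel : Config Δ → (Bool →₀ ℕ) → Prop}
    (h : Simulates boot op Rel) {N : List ℕ} (hboot : boot.WF N) (hop : ∀ o, (op o).WF N)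
    {C : DMS → Prop} (hC : ∀ m s E, C (counterDMS N boot (optAction op) m s E)) :
    ¬ ModelCheckingDecidable Δ C ∧ ¬ PropReachDecidable Δ C ∧ ¬ RunReachDecidable Δ C := by
  obtain ⟨E, m, s, t, hE, hs, ht, hK⟩ := exists_undecidable_machine
  refine undecidable_of_reduction (p := N.length + (1 + t))
    (computable_counterDMS N boot (optAction op) m s E)
    (fun n => counterDMS_wf hboot hop (by omega) fun e he => ?_) (fun n => hC _ _ _)
    (fun n => counterDMS_isProp _ _ _ _ _ (by omega))
    (fun n => by simp [counterDMS, counterActs]) ?_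
  · simp only [loadEdges, List.cons_append, List.mem_cons, List.mem_append, List.mem_map,
      List.mem_range] at he
    rcases he with rfl | ⟨j, hj, rfl⟩ | he
    · simp only
      omega
    · simp only
      omega
    · have := hE e he
      omega
  · simpa only [← add_assoc, h.propReach_iff] using hK

/-! ### Counters as unary relations -/

/-- The actions for counters that are the cardinalities of the unary relations `r false` and
`r true`. -/
def unaryOp (r : Bool → ℕ) : CounterOp Bool → DMSAction
  | .inc b => ⟨[], [0], .tru, [], [(r b, [0])]⟩
  | .dec b => ⟨[0], [], .rel (r b) [0], [(r b, [0])], []⟩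
  | .zero b => ⟨[], [], .neg (.ex 0 (.rel (r b) [0])), [], []⟩

theorem unaryOp_wf {N : List ℕ} {r : Bool → ℕ} (hr : ∀ b, N[r b]? = some 1) (o : CounterOp Bool) :
    (unaryOp r o).WF N := by
  cases o <;> constructor <;> simp [unaryOp, Query.Over, Query.free, DBFact.Over, hr]

/-- The instance with the unary relations `A false` and `A true`. -/
def unaryDB {Δ : Type*} (r : Bool → ℕ) (A : Bool → Finset Δ) : DB Δ :=
  {f | ∃ b, ∃ e ∈ A b, f = (r b, [e])}

theorem mem_unaryDB {Δ : Type*} {r : Bool → ℕ} (hr : Function.Injective r) {A : Bool → Finset Δ}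
    {b : Bool} {e : Δ} : (r b, [e]) ∈ unaryDB r A ↔ e ∈ A b := by
  simp only [unaryDB, Set.mem_ofPred_eq, Prod.mk.injEq, List.cons.injEq, and_true]
  constructor
  · rintro ⟨b', e', he, hb, rfl⟩
    rwa [hr hb]
  · exact fun h => ⟨b, e, h, rfl, rfl⟩

/-- The configurations in which the unary relations represent the counters. -/
def unaryRel {Δ : Type*} (r : Bool → ℕ) (c : Config Δ) (n : Bool →₀ ℕ) : Prop :=
  ∃ A : Bool → Finset Δ, c.1 = unaryDB r A ∧ (∀ b, (A b).card = n b) ∧ (∀ b, ∀ e ∈ A b, e ∈ c.2) ∧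
    c.2.Finite

/-- All stored values belong to the history, so a value outside the history is new to the relation
and raises its cardinality by one. Finiteness of the history is carried along because it guarantees
that fresh values exist. -/
theorem unaryRel_inc {Δ : Type*} {r : Bool → ℕ} {A : Bool → Finset Δ} {H : Set Δ} {n : Bool →₀ ℕ}
    (hA : ∀ b, (A b).card = n b) (hH : ∀ b, ∀ e ∈ A b, e ∈ H) (hf : H.Finite) {b : Bool} {σ : ℕ → Δ}
    (hσ : σ 0 ∉ H) :
    unaryRel r ((unaryOp r (.inc b)).result (unaryDB r A, H) σ) (n + Finsupp.single b 1) := by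
  classical
  refine ⟨Function.update A b (insert (σ 0) (A b)), ?_, fun b' => ?_, fun b' e he => ?_, ?_⟩
  · ext f
    simp only [DMSAction.result, unaryOp, substDB, unaryDB, List.not_mem_nil, List.mem_singleton,
      Set.mem_union, Set.mem_sdiff, Set.mem_ofPred_eq, false_and, exists_false, not_false_eq_true,
      and_true, exists_eq_left, List.map_cons, List.map_nil]
    constructor
    · rintro (⟨b', e, he, rfl⟩ | rfl)
      · refine ⟨b', e, ?_, rfl⟩
        rcases eq_or_ne b' b with rfl | h <;> simp [*]
      · exact ⟨b, σ 0, by simp, rfl⟩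
    · rintro ⟨b', e, he, rfl⟩
      rcases eq_or_ne b' b with rfl | h
      · simp only [Function.update_self, Finset.mem_insert] at he
        rcases he with rfl | he
        · exact .inr rfl
        · exact .inl ⟨_, e, he, rfl⟩
      · rw [Function.update_of_ne h] at he
        exact .inl ⟨b', e, he, rfl⟩
  · rcases eq_or_ne b' b with rfl | h
    · rw [Function.update_self, Finset.card_insert_of_notMem fun h => hσ (hH _ _ h), hA]
      simp
    · rw [Function.update_of_ne h, hA]
      simp [h.symm]
  · simp only [DMSAction.result, unaryOp, List.mem_singleton, exists_eq_left, Set.mem_union,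
      Set.mem_ofPred_eq]
    rcases eq_or_ne b' b with rfl | h
    · simp only [Function.update_self, Finset.mem_insert] at he
      exact he.symm.imp (hH _ _) Eq.symm
    · rw [Function.update_of_ne h] at he
      exact .inl (hH _ _ he)
  · refine hf.union ((Set.finite_singleton (σ 0)).subset ?_)
    simp [unaryOp]

theorem unaryRel_dec {Δ : Type*} {r : Bool → ℕ} (hr : Function.Injective r) {A : Bool → Finset Δ}
    {H : Set Δ} {n : Bool →₀ ℕ} (hA : ∀ b, (A b).card = n b) (hH : ∀ b, ∀ e ∈ A b, e ∈ H)
    (hf : H.Finite) {b : Bool} {σ : ℕ → Δ} (hσ : σ 0 ∈ A b) :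
    unaryRel r ((unaryOp r (.dec b)).result (unaryDB r A, H) σ) (n - Finsupp.single b 1) := by
  classical
  refine ⟨Function.update A b ((A b).erase (σ 0)), ?_, fun b' => ?_, fun b' e he => ?_, ?_⟩
  · ext f
    simp only [DMSAction.result, unaryOp, substDB, unaryDB, List.not_mem_nil, List.mem_singleton,
      Set.mem_union, Set.mem_sdiff, Set.mem_ofPred_eq, false_and, exists_false, or_false,
      exists_eq_left, List.map_cons, List.map_nil]
    constructor
    · rintro ⟨⟨b', e, he, rfl⟩, hne⟩
      refine ⟨b', e, ?_, rfl⟩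
      rcases eq_or_ne b' b with rfl | h
      · rw [Function.update_self]
        exact Finset.mem_erase.2 ⟨fun h => hne (by rw [h]), he⟩
      · rwa [Function.update_of_ne h]
    · rintro ⟨b', e, he, rfl⟩
      rcases eq_or_ne b' b with rfl | h
      · rw [Function.update_self] at he
        obtain ⟨hne, he⟩ := Finset.mem_erase.1 he
        exact ⟨⟨_, e, he, rfl⟩, by simpa using hne⟩
      · rw [Function.update_of_ne h] at he
        exact ⟨⟨b', e, he, rfl⟩, fun h' => h (hr (Prod.mk.inj h').1)⟩
  · rcases eq_or_ne b' b with rfl | h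
    · rw [Function.update_self, Finset.card_erase_of_mem hσ, hA]
      simp
    · rw [Function.update_of_ne h, hA]
      simp [h.symm]
  · refine .inl (hH b' e ?_)
    rcases eq_or_ne b' b with rfl | h
    · rw [Function.update_self] at he
      exact Finset.mem_of_mem_erase he
    · rwa [Function.update_of_ne h] at he
  · refine hf.union (Set.finite_empty.subset ?_)
    simp [unaryOp]

theorem unaryOp_zero_result {Δ : Type*} (r : Bool → ℕ) (b : Bool) (c : Config Δ) (σ : ℕ → Δ) :
    (unaryOp r (.zero b)).result c σ = c := by
  ext <;> simp [unaryOp, DMSAction.result, substDB]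

/-- Boot is the idle action, since empty relations already represent zero counters. Only the zero
test uses negation in a guard. -/
theorem unary_simulates {Δ : Type*} [Infinite Δ] {r : Bool → ℕ} (hr : Function.Injective r) :
    Simulates (Δ := Δ) .idle (unaryOp r) (unaryRel r) where
  boot_noProps := by simp [DMSAction.NoProps, DMSAction.idle]
  op_noProps o := by cases o <;> simp [DMSAction.NoProps, unaryOp]
  rel_noProps := by
    rintro ⟨D, H⟩ n ⟨A, rfl : D = _, -⟩ f ⟨b, e, -, rfl⟩
    simp
  boot_exists p := ⟨fun _ => Classical.arbitrary Δ, DMSAction.idle_instantiates _ _⟩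
  boot_rel p σ _ := by
    rw [DMSAction.idle_result]
    exact ⟨fun _ => ∅, by simp [unaryDB], by simp, by simp, Set.finite_empty⟩
  op_exists := by
    rintro o ⟨D, H⟩ n n' p ⟨A, rfl : D = _, hA, hH, hf⟩ hs
    cases o with
    | inc b =>
      obtain ⟨v, hv⟩ := hf.exists_notMem
      obtain rfl : n' = _ := hs
      refine ⟨fun _ => v, ?_, unaryRel_inc hA hH hf hv⟩
      constructor <;> simp [unaryOp, Query.Sat]
      exact hv
    | dec b =>
      obtain rfl : n = _ := hs
      have hne : (A b).Nonempty := by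
        rw [← Finset.card_pos, hA]
        simp
      obtain ⟨v, hv⟩ := hne
      have hmem := (mem_unaryDB hr).2 hv
      refine ⟨fun _ => v, ⟨?_, ?_, ?_, .inr hmem⟩, ?_⟩
      · simp only [unaryOp, List.mem_singleton, forall_eq]
        exact ⟨_, .inr hmem, by simp⟩
      · simp [unaryOp]
      · simp [unaryOp]
      · have := unaryRel_dec hr hA hH hf (σ := fun _ => v) hv
        rwa [add_tsub_cancel_right] at this
    | zero b =>
      obtain ⟨hz, rfl⟩ := hs
      have hempty : A b = ∅ := by rw [← Finset.card_eq_zero, hA, hz]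
      refine ⟨fun _ => Classical.arbitrary Δ, ?_, ?_⟩
      · constructor <;> simp [unaryOp, Query.Sat, mem_unaryDB hr, hempty]
      · rw [unaryOp_zero_result]
        exact ⟨A, rfl, hA, hH, hf⟩
  op_sound := by
    rintro o ⟨D, H⟩ n p σ ⟨A, rfl : D = _, hA, hH, hf⟩ hσ
    cases o with
    | inc b => exact ⟨_, rfl, unaryRel_inc hA hH hf (hσ.hist_fresh 0 (by simp [unaryOp]))⟩
    | dec b =>
      have hmem : σ 0 ∈ A b := by
        have := hσ.sat
        simpa [unaryOp, Query.Sat, mem_unaryDB hr] using this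
      refine ⟨_, ?_, unaryRel_dec hr hA hH hf hmem⟩
      refine (tsub_add_cancel_of_le ?_).symm
      rw [Finsupp.single_le_iff, ← hA]
      exact Finset.card_pos.2 ⟨_, hmem⟩
    | zero b =>
      refine ⟨n, ⟨?_, rfl⟩, ?_⟩
      · rw [← hA, Finset.card_eq_zero, Finset.eq_empty_iff_forall_notMem]
        intro e he
        have hmem := (mem_unaryDB hr).2 he
        refine hσ.sat ⟨e, ⟨_, .inr hmem, by simp⟩, .inr ?_⟩
        simpa using hmem
      · rw [unaryOp_zero_result]
        exact ⟨A, rfl, hA, hH, hf⟩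

/-! ### Counters as lists in a binary relation -/

/-- The edges of a rigid directed graph.  The nodes `3` and `4` are the heads of the two lists, and
the node `5` is the common end of the lists. -/
def coreEdges : List (Fin 6 × Fin 6) :=
  [(0, 1), (1, 0), (1, 2), (2, 0), (0, 3), (1, 3), (0, 4), (2, 4), (2, 5)]

/-- The head of the list that represents a counter. -/
def listHead (b : Bool) : Fin 6 := bif b then 4 else 3

/-- The conjunction of the edges of the rigid graph. -/
def coreGuard (r : ℕ) : Query :=
  coreEdges.foldr (fun e q => .and (.rel r [(e.1 : ℕ), (e.2 : ℕ)]) q) .tru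

/-- The action that creates the rigid graph and two empty lists. -/
def binaryBoot (r : ℕ) : DMSAction :=
  ⟨[], [0, 1, 2, 3, 4, 5], .tru, [],
    (r, [3, 5]) :: (r, [4, 5]) :: coreEdges.map fun e => (r, [(e.1 : ℕ), (e.2 : ℕ)])⟩

/-- The actions for counters that are the lengths of lists in the binary relation `r`. -/
def binaryOp (r : ℕ) : CounterOp Bool → DMSAction
  | .inc b => ⟨[0, 1, 2, 3, 4, 5, 6], [7], .and (.rel r [(listHead b : ℕ), 6]) (coreGuard r),
      [(r, [(listHead b : ℕ), 6])], [(r, [(listHead b : ℕ), 7]), (r, [7, 6])]⟩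
  | .dec b => ⟨[0, 1, 2, 3, 4, 5, 6, 7], [], .and (.rel r [(listHead b : ℕ), 6])
      (.and (.rel r [6, 7]) (coreGuard r)),
      [(r, [(listHead b : ℕ), 6])], [(r, [(listHead b : ℕ), 7])]⟩
  | .zero b => ⟨[0, 1, 2, 3, 4, 5], [], .and (.rel r [(listHead b : ℕ), 5]) (coreGuard r), [], []⟩

theorem coreGuard_isConj (r : ℕ) : (coreGuard r).IsConj := by
  unfold coreGuard
  induction coreEdges with
  | nil => exact .tru
  | cons e l ih => exact .and (.rel _ _) ih

theorem coreGuard_over {R : Schema} {r : ℕ} (hr : R[r]? = some 2) : (coreGuard r).Over R := by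
  unfold coreGuard
  induction coreEdges with
  | nil => trivial
  | cons e l ih => exact ⟨hr, ih⟩

theorem coreGuard_sat {Δ : Type*} {I : DB Δ} {r : ℕ} {σ : ℕ → Δ} :
    (coreGuard r).Sat I σ ↔ ∀ e ∈ coreEdges, (r, [σ e.1, σ e.2]) ∈ I := by
  unfold coreGuard
  induction coreEdges with
  | nil => simp [Query.Sat]
  | cons e l ih => simp only [List.foldr_cons, Query.Sat, ih, List.forall_mem_cons, List.map_cons,
      List.map_nil]

theorem mem_coreGuard_free {r u : ℕ} : u ∈ (coreGuard r).free ↔ u < 6 := by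
  simp [coreGuard, coreEdges, Query.free]
  omega

theorem binaryOp_isConj (r : ℕ) (o : CounterOp Bool) : (binaryOp r o).guard.IsConj := by
  cases o with
  | inc b => exact .and (.rel _ _) (coreGuard_isConj r)
  | dec b => exact .and (.rel _ _) (.and (.rel _ _) (coreGuard_isConj r))
  | zero b => exact .and (.rel _ _) (coreGuard_isConj r)

theorem binaryBoot_wf {N : List ℕ} {r : ℕ} (hr : N[r]? = some 2) : (binaryBoot r).WF N := by
  constructor <;> simp [binaryBoot, Query.Over, Query.free, DBFact.Over, hr, coreEdges]

theorem binaryOp_wf {N : List ℕ} {r : ℕ} (hr : N[r]? = some 2) (o : CounterOp Bool) :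
    (binaryOp r o).WF N := by
  have hl : ∀ b, (listHead b : ℕ) = 3 ∨ (listHead b : ℕ) = 4 := by decide
  cases o with
  | inc b =>
    have := hl b
    constructor <;> simp [binaryOp, Query.Over, Query.free, DBFact.Over, hr, coreGuard_over hr,
      mem_coreGuard_free] <;> omega
  | dec b =>
    have := hl b
    constructor <;> simp [binaryOp, Query.Over, Query.free, DBFact.Over, hr, coreGuard_over hr,
      mem_coreGuard_free] <;> omega
  | zero b =>
    have := hl b
    constructor <;> simp [binaryOp, Query.Over, Query.free, DBFact.Over, hr, coreGuard_over hr,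
      mem_coreGuard_free]
    omega

/-- The edges of the rigid graph with the nodes `x`, together with the edges given by the partial
function `g`. -/
def CoreEdge {Δ : Type*} (x : Fin 6 → Δ) (g : Δ → Option Δ) (u v : Δ) : Prop :=
  (∃ e ∈ coreEdges, u = x e.1 ∧ v = x e.2) ∨ g u = some v

/-- The conditions under which the graph with the edges `CoreEdge x g` has only one copy of the rigid
graph. -/
structure IsCore {Δ : Type*} (x : Fin 6 → Δ) (g : Δ → Option Δ) : Prop where
  inj : Function.Injective x
  g_zero : g (x 0) = none
  g_one : g (x 1) = none
  g_two : g (x 2) = none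
  g_five : g (x 5) = none
  not_range : ∀ u, ∀ i < 5, g u ≠ some (x i)
  irrefl : ∀ u, g u ≠ some u

/-! ### Rigidity of the core graph -/

namespace IsCore

variable {Δ : Type*} {x : Fin 6 → Δ} {g : Δ → Option Δ}

theorem edge_zero (h : IsCore x g) {v : Δ} : CoreEdge x g (x 0) v ↔ v = x 1 ∨ v = x 3 ∨ v = x 4 := by
  simp [CoreEdge, coreEdges, h.inj.eq_iff, h.g_zero]

theorem edge_one (h : IsCore x g) {v : Δ} : CoreEdge x g (x 1) v ↔ v = x 0 ∨ v = x 2 ∨ v = x 3 := by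
  simp [CoreEdge, coreEdges, h.inj.eq_iff, h.g_one]

theorem edge_two (h : IsCore x g) {v : Δ} : CoreEdge x g (x 2) v ↔ v = x 0 ∨ v = x 4 ∨ v = x 5 := by
  simp [CoreEdge, coreEdges, h.inj.eq_iff, h.g_two]

theorem edge_of_ne {u v : Δ} (h₀ : u ≠ x 0) (h₁ : u ≠ x 1) (h₂ : u ≠ x 2) :
    CoreEdge x g u v ↔ g u = some v := by
  simp [CoreEdge, coreEdges, h₀, h₁, h₂]

theorem edge_of_ge (h : IsCore x g) {i : Fin 6} (hi : 3 ≤ i) {v : Δ} : CoreEdge x g (x i) v ↔ g (x i) = some v := by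
  apply edge_of_ne <;> rw [h.inj.ne_iff] <;> omega

theorem edge_irrefl (h : IsCore x g) (u : Δ) : ¬ CoreEdge x g u u := by
  intro hu
  by_cases h₀ : u = x 0
  · subst h₀
    simp [h.edge_zero, h.inj.eq_iff] at hu
  by_cases h₁ : u = x 1
  · subst h₁
    simp [h.edge_one, h.inj.eq_iff] at hu
  by_cases h₂ : u = x 2
  · subst h₂
    simp [h.edge_two, h.inj.eq_iff] at hu
  exact h.irrefl u ((edge_of_ne h₀ h₁ h₂).1 hu)

theorem not_edge (h : IsCore x g) {i j : Fin 6} (hi : 3 ≤ i) (hj : j < 5) : ¬ CoreEdge x g (x i) (x j) := fun hij =>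
  h.not_range _ j hj ((h.edge_of_ge hi).1 hij)

/-- The variables of a guard may coincide, so `y` is an arbitrary homomorphic image. Outside the
core nodes 0, 1, 2 out-degrees are at most one and there are no loops, while `y 0` has the
out-neighbours `y 1` and `y 3` with an edge between them; hence `y 0` is one of these three nodes.
The edges among 0, 1, 2 exclude the nodes 1 and 2 and then determine `y 1` and `y 2`. The heads
follow as the only common out-neighbours of 0 and 1, and of 0 and 2. The end node is found only up
to three candidates; the zero test removes the wrong ones by its additional edge from a head. -/
theorem unique (h : IsCore x g) {y : Fin 6 → Δ} (hy : ∀ e ∈ coreEdges, CoreEdge x g (y e.1) (y e.2)) :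
    (∀ i < 5, y i = x i) ∧ (y 5 = x 0 ∨ y 5 = x 4 ∨ y 5 = x 5) := by
  simp only [coreEdges, List.forall_mem_cons, List.not_mem_nil, false_implies, implies_true,
    and_true] at hy
  obtain ⟨h01, h10, h12, h20, h03, h13, h04, h24, h25⟩ := hy
  have hne : ∀ {i j : Fin 6}, i ≠ j → x i ≠ x j := fun hij => h.inj.ne hij
  have h0 : y 0 = x 0 := by
    by_cases c₀ : y 0 = x 0
    · exact c₀
    exfalso
    by_cases c₁ : y 0 = x 1
    · rw [c₁] at h01 h10 h20
      rcases h.edge_one.1 h01 with e | e | e <;> rw [e] at h10 h12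
      · rcases h.edge_zero.1 h12 with e' | e' | e' <;> rw [e'] at h20
        · exact h.edge_irrefl _ h20
        · exact h.not_edge (by decide) (by decide) h20
        · exact h.not_edge (by decide) (by decide) h20
      · simp [h.edge_two, h.inj.eq_iff] at h10
      · exact h.not_edge (by decide) (by decide) h10
    by_cases c₂ : y 0 = x 2
    · rw [c₂] at h01 h10
      rcases h.edge_two.1 h01 with e | e | e <;> rw [e] at h10
      · simp [h.edge_zero, h.inj.eq_iff] at h10
      · exact h.not_edge (by decide) (by decide) h10
      · exact h.not_edge (by decide) (by decide) h10
    -- Here `y 0` has at most one out-edge, so `y 1 = y 3`, and the edge between them would be a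
    -- loop.
    rw [edge_of_ne c₀ c₁ c₂] at h01 h03
    obtain e : y 1 = y 3 := Option.some.inj (h01.symm.trans h03)
    rw [← e] at h13
    exact h.edge_irrefl _ h13
  rw [h0] at h01 h10 h20 h03 h04
  have h1 : y 1 = x 1 := by
    rcases h.edge_zero.1 h01 with e | e | e
    · exact e
    · rw [e] at h10
      exact (h.not_edge (by decide) (by decide) h10).elim
    · rw [e] at h10
      exact (h.not_edge (by decide) (by decide) h10).elim
  rw [h1] at h12 h13
  have h2 : y 2 = x 2 := by
    rcases h.edge_one.1 h12 with e | e | e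
    · rw [e] at h20
      exact (h.edge_irrefl _ h20).elim
    · exact e
    · rw [e] at h20
      exact (h.not_edge (by decide) (by decide) h20).elim
  rw [h2] at h24 h25
  have h3 : y 3 = x 3 := by
    rcases h.edge_zero.1 h03 with e | e | e
    · simp [e, h.edge_one, h.inj.eq_iff] at h13
    · exact e
    · simp [e, h.edge_one, h.inj.eq_iff] at h13
  have h4 : y 4 = x 4 := by
    rcases h.edge_zero.1 h04 with e | e | e
    · simp [e, h.edge_two, h.inj.eq_iff] at h24
    · simp [e, h.edge_two, h.inj.eq_iff] at h24
    · exact e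
  refine ⟨fun i hi => ?_, h.edge_two.1 h25⟩
  obtain rfl | rfl | rfl | rfl | rfl : i = 0 ∨ i = 1 ∨ i = 2 ∨ i = 3 ∨ i = 4 := by omega
  exacts [h0, h1, h2, h3, h4]

end IsCore

/-! ### Lists as paths of a partial function -/

/-- The instance with the binary relation `Ed`. -/
def edgeDB {Δ : Type*} (r : ℕ) (Ed : Δ → Δ → Prop) : DB Δ := {f | ∃ u v, Ed u v ∧ f = (r, [u, v])}

theorem mem_edgeDB {Δ : Type*} {r : ℕ} {Ed : Δ → Δ → Prop} {u v : Δ} :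
    (r, [u, v]) ∈ edgeDB r Ed ↔ Ed u v := by
  simp [edgeDB]

theorem edgeDB_update {Δ : Type*} {Ed Ed' : Δ → Δ → Prop} (r : ℕ) (σ : ℕ → Δ)
    (del add : List (ℕ × ℕ)) (h : ∀ u v, Ed' u v ↔
      (Ed u v ∧ ¬ ∃ e ∈ del, u = σ e.1 ∧ v = σ e.2) ∨ ∃ e ∈ add, u = σ e.1 ∧ v = σ e.2) :
    (edgeDB r Ed \ substDB σ (del.map fun e => (r, [e.1, e.2]))) ∪
      substDB σ (add.map fun e => (r, [e.1, e.2])) = edgeDB r Ed' := by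
  have hs : ∀ (l : List (ℕ × ℕ)) (f : DBFact Δ),
      f ∈ substDB σ (l.map fun e => (r, [e.1, e.2])) ↔ ∃ e ∈ l, f = (r, [σ e.1, σ e.2]) := by
    intro l f
    simp only [substDB, Set.mem_ofPred_eq, List.mem_map]
    constructor
    · rintro ⟨_, ⟨e, he, rfl⟩, rfl⟩
      exact ⟨e, he, rfl⟩
    · rintro ⟨e, he, rfl⟩
      exact ⟨_, ⟨e, he, rfl⟩, rfl⟩
  have hpair : ∀ u v u' v' : Δ, (r, [u, v]) = (r, [u', v']) ↔ u = u' ∧ v = v' := by simp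
  ext f
  rw [Set.mem_union, Set.mem_sdiff, hs, hs]
  constructor
  · rintro (⟨⟨u, v, huv, rfl⟩, hd⟩ | ⟨e, he, rfl⟩)
    · simp only [hpair] at hd
      exact ⟨u, v, (h u v).2 (.inl ⟨huv, hd⟩), rfl⟩
    · exact ⟨_, _, (h _ _).2 (.inr ⟨e, he, rfl, rfl⟩), rfl⟩
  · rintro ⟨u, v, huv, rfl⟩
    simp only [mem_edgeDB, hpair]
    exact (h u v).1 huv

/-- The path of the partial function `g` from a node reaches `d` in `k + 1` steps. -/
def IsPath {Δ : Type*} (g : Δ → Option Δ) (d : Δ) : ℕ → Δ → Prop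
  | 0, u => g u = some d
  | k + 1, u => ∃ v, g u = some v ∧ IsPath g d k v

/-- No edge of `g` enters `z`, so a path that starts elsewhere never meets the changed value. -/
theorem IsPath.update {Δ : Type*} [DecidableEq Δ] {g : Δ → Option Δ} {d z : Δ} {w : Option Δ}
    (hz : ∀ u, g u ≠ some z) {k : ℕ} {u : Δ} (hu : u ≠ z) (h : IsPath g d k u) :
    IsPath (Function.update g z w) d k u := by
  induction k generalizing u with
  | zero => rwa [IsPath, Function.update_of_ne hu]
  | succ k ih =>
    obtain ⟨v, hv, h⟩ := h
    refine ⟨v, by rwa [Function.update_of_ne hu], ih ?_ h⟩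
    rintro rfl
    exact hz u hv

/-- The configurations in which lists in the binary relation `r` represent the counters. -/
def binaryRel {Δ : Type*} (r : ℕ) (c : Config Δ) (n : Bool →₀ ℕ) : Prop :=
  ∃ (x : Fin 6 → Δ) (g : Δ → Option Δ), IsCore x g ∧ c.1 = edgeDB r (CoreEdge x g) ∧
    (∀ b, IsPath g (x 5) (n b) (x (listHead b))) ∧ c.2.Finite ∧ (∀ i, x i ∈ c.2) ∧
    ∀ u v, g u = some v → u ∈ c.2 ∧ v ∈ c.2

theorem listHead_ge (b : Bool) : 3 ≤ listHead b := by cases b <;> decide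
theorem listHead_lt (b : Bool) : listHead b < 5 := by cases b <;> decide
theorem listHead_injective : Function.Injective listHead := by decide

/-- The new target may be the end node `x 5`, as for an empty list, but no other core node. In
particular it is not the head itself, so no loop arises. -/
theorem IsCore.update_head {Δ : Type*} [DecidableEq Δ] {x : Fin 6 → Δ} {g : Δ → Option Δ}
    (h : IsCore x g) (b : Bool) {v : Δ} (hv : ∀ i < 5, v ≠ x i) :
    IsCore x (Function.update g (x (listHead b)) (some v)) := by
  have hl₃ := listHead_ge b
  have hl₅ := listHead_lt b
  have hne : ∀ i : Fin 6, i ≠ listHead b → x i ≠ x (listHead b) := fun i hi => h.inj.ne hi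
  refine ⟨h.inj, ?_, ?_, ?_, ?_, fun u i hi => ?_, fun u => ?_⟩
  · rw [Function.update_of_ne (hne _ (by omega)), h.g_zero]
  · rw [Function.update_of_ne (hne _ (by omega)), h.g_one]
  · rw [Function.update_of_ne (hne _ (by omega)), h.g_two]
  · rw [Function.update_of_ne (hne _ (by omega)), h.g_five]
  · rcases eq_or_ne u (x (listHead b)) with rfl | hu
    · rw [Function.update_self]
      exact fun e => hv i hi (Option.some.inj e)
    · rw [Function.update_of_ne hu]
      exact h.not_range u i hi
  · rcases eq_or_ne u (x (listHead b)) with rfl | hu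
    · rw [Function.update_self]
      exact fun e => hv _ hl₅ (Option.some.inj e)
    · rw [Function.update_of_ne hu]
      exact h.irrefl u

/-- A head is the source of no edge of the rigid graph, so its only out-edge is the one given by
`g`. Redirecting `g` there is the same as deleting one fact and adding one. -/
theorem IsCore.coreEdge_update_head {Δ : Type*} [DecidableEq Δ] {x : Fin 6 → Δ}
    {g : Δ → Option Δ} (h : IsCore x g) {b : Bool} {v w : Δ} (hw : g (x (listHead b)) = some w)
    (u u' : Δ) : CoreEdge x (Function.update g (x (listHead b)) (some v)) u u' ↔
      (CoreEdge x g u u' ∧ ¬ (u = x (listHead b) ∧ u' = w)) ∨ (u = x (listHead b) ∧ u' = v) := by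
  rcases eq_or_ne u (x (listHead b)) with rfl | hu
  · have hl := listHead_ge b
    rw [edge_of_ne, h.edge_of_ge hl, hw, Function.update_self]
    · simp only [Option.some.injEq, true_and]
      constructor
      · rintro rfl
        exact .inr rfl
      · rintro (⟨rfl, hne⟩ | rfl)
        · exact absurd rfl hne
        · rfl
    all_goals
      rw [h.inj.ne_iff]
      omega
  · simp [CoreEdge, hu]

/-! ### Effect of the actions on the lists -/

section Result

variable {Δ : Type*} {r : ℕ} {x : Fin 6 → Δ} {g : Δ → Option Δ} {H : Set Δ} {n : Bool →₀ ℕ}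

/-- The fresh node is inserted between the head and its old successor by two updates of `g`: first
it is linked to the old successor, then the head is redirected to it. Lying outside the history, it
touches no old edge, so the first update preserves all lists; the second one cannot disturb the
other list, because no edge leads to a head. -/
theorem binaryRel_inc (hc : IsCore x g) (hp : ∀ b, IsPath g (x 5) (n b) (x (listHead b)))
    (hf : H.Finite) (hx : ∀ i, x i ∈ H) (hH : ∀ u v, g u = some v → u ∈ H ∧ v ∈ H) {b : Bool}
    {σ : ℕ → Δ} (hσ : σ (listHead b) = x (listHead b)) (h6 : g (x (listHead b)) = some (σ 6))
    (h7 : σ 7 ∉ H) :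
    binaryRel r ((binaryOp r (.inc b)).result (edgeDB r (CoreEdge x g), H) σ)
      (n + Finsupp.single b 1) := by
  classical
  have hne : ∀ {u}, u ∈ H → u ≠ σ 7 := fun hu e => h7 (e ▸ hu)
  have hnr : ∀ u, g u ≠ some (σ 7) := fun u hu => h7 (hH _ _ hu).2
  have h7n : g (σ 7) = none := by
    by_contra hs
    obtain ⟨w, hw⟩ := Option.ne_none_iff_exists'.1 hs
    exact h7 (hH _ _ hw).1
  let g₁ := Function.update g (σ 7) (some (σ 6))
  have g₁_of_mem : ∀ {u}, u ∈ H → g₁ u = g u := fun hu => Function.update_of_ne (hne hu) _ _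
  have g₁_self : g₁ (σ 7) = some (σ 6) := Function.update_self _ _ _
  have g₁_some : ∀ {u v}, g₁ u = some v → g u = some v ∨ (u = σ 7 ∧ v = σ 6) := by
    intro u v huv
    rcases eq_or_ne u (σ 7) with rfl | hu
    · rw [g₁_self] at huv
      exact .inr ⟨rfl, (Option.some.inj huv).symm⟩
    · exact .inl (by rwa [show g₁ u = g u from Function.update_of_ne hu _ _] at huv)
  have hc₁ : IsCore x g₁ := by
    refine ⟨hc.inj, ?_, ?_, ?_, ?_, fun u i hi hu => ?_, fun u hu => ?_⟩
    · rw [g₁_of_mem (hx _), hc.g_zero]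
    · rw [g₁_of_mem (hx _), hc.g_one]
    · rw [g₁_of_mem (hx _), hc.g_two]
    · rw [g₁_of_mem (hx _), hc.g_five]
    · rcases g₁_some hu with hu | ⟨-, hu⟩
      · exact hc.not_range u i hi hu
      · exact hc.not_range _ i hi (hu ▸ h6)
    · rcases g₁_some hu with hu | ⟨rfl, hu⟩
      · exact hc.irrefl u hu
      · exact hnr _ (hu ▸ h6)
  have hnr₁ : ∀ b u, g₁ u ≠ some (x (listHead b)) := fun b u => hc₁.not_range u _ (listHead_lt b)
  have hp₁ : ∀ b, IsPath g₁ (x 5) (n b) (x (listHead b)) := fun b =>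
    (hp b).update hnr (hne (hx _))
  refine ⟨x, Function.update g₁ (x (listHead b)) (some (σ 7)),
    hc₁.update_head b fun i _ => (hne (hx i)).symm, ?_, fun b' => ?_, ?_, fun i => .inl (hx i),
      fun u v huv => ?_⟩
  · refine edgeDB_update r σ [(listHead b, 6)] [(listHead b, 7), (7, 6)] fun u v => ?_
    rw [hc₁.coreEdge_update_head ((g₁_of_mem (hx _)).trans h6)]
    simp only [exists_eq_left, List.mem_cons, List.not_mem_nil, or_false, exists_eq_or_imp, hσ]
    have : CoreEdge x g₁ u v ↔ CoreEdge x g u v ∨ (u = σ 7 ∧ v = σ 6) := by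
      unfold CoreEdge
      rw [or_assoc]
      refine or_congr_right ⟨g₁_some, ?_⟩
      rintro (huv | ⟨rfl, rfl⟩)
      · rw [g₁_of_mem (hH _ _ huv).1, huv]
      · exact g₁_self
    rw [this]
    have h₁ : u = σ 7 → u ≠ x (listHead b) := fun e e' => hne (hx _) (e'.symm.trans e)
    tauto
  · rcases eq_or_ne b' b with rfl | hb
    · rw [Finsupp.add_apply, Finsupp.single_eq_same]
      refine ⟨σ 7, Function.update_self _ _ _, ?_⟩
      have hne' : σ 7 ≠ x (listHead b') := (hne (hx _)).symm
      refine IsPath.update (hnr₁ _) hne' ?_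
      generalize hk : n b' = k
      have hpk := hp₁ b'
      rw [hk] at hpk
      -- For an empty list the old successor `σ 6` is the end node itself.
      cases k with
      | zero =>
        have e : σ 6 = x 5 := by
          rw [IsPath, g₁_of_mem (hx _), h6] at hpk
          exact Option.some.inj hpk
        rw [IsPath, g₁_self, e]
      | succ k =>
        obtain ⟨w, hw, hpk⟩ := hpk
        rw [g₁_of_mem (hx _), h6] at hw
        obtain rfl := Option.some.inj hw
        exact ⟨σ 6, g₁_self, hpk⟩
    · rw [Finsupp.add_apply, Finsupp.single_eq_of_ne hb, add_zero]
      exact (hp₁ b').update (hnr₁ _) (hc.inj.ne (listHead_injective.ne hb))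
  · refine hf.union ((Set.finite_singleton (σ 7)).subset ?_)
    simp [binaryOp]
  · have h7' : σ 7 ∈ H ∪ {e | ∃ v ∈ (binaryOp r (.inc b)).fresh, σ v = e} :=
      .inr ⟨7, by simp [binaryOp], rfl⟩
    rcases eq_or_ne u (x (listHead b)) with rfl | hu
    · rw [Function.update_self] at huv
      rw [← Option.some.inj huv]
      exact ⟨.inl (hx _), h7'⟩
    · rw [Function.update_of_ne hu] at huv
      rcases g₁_some huv with huv | ⟨rfl, rfl⟩
      · exact ⟨.inl (hH _ _ huv).1, .inl (hH _ _ huv).2⟩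
      · exact ⟨h7', .inl (hH _ _ h6).2⟩

/-- The first cell is bypassed. Its own edge stays in the relation as garbage, which is harmless
because `IsCore` tolerates arbitrary further edges of this kind. -/
theorem binaryRel_dec (hc : IsCore x g) (hp : ∀ b, IsPath g (x 5) (n b) (x (listHead b)))
    (hf : H.Finite) (hx : ∀ i, x i ∈ H) (hH : ∀ u v, g u = some v → u ∈ H ∧ v ∈ H) {b : Bool}
    {σ : ℕ → Δ} (hσ : σ (listHead b) = x (listHead b)) (h6 : g (x (listHead b)) = some (σ 6))
    (h7 : g (σ 6) = some (σ 7)) :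
    Finsupp.single b 1 ≤ n ∧
    binaryRel r ((binaryOp r (.dec b)).result (edgeDB r (CoreEdge x g), H) σ)
      (n - Finsupp.single b 1) := by
  classical
  have hnr : ∀ b u, g u ≠ some (x (listHead b)) := fun b u => hc.not_range u _ (listHead_lt b)
  -- For an empty list `σ 6` would be the end node, which has no outgoing edge.
  obtain ⟨k, hk⟩ : ∃ k, n b = k + 1 := by
    refine Nat.exists_eq_succ_of_ne_zero fun h0 => ?_
    have h := hp b
    rw [h0, IsPath, h6] at h
    rw [Option.some.inj h, hc.g_five] at h7
    cases h7
  have hpk : IsPath g (x 5) k (σ 6) := by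
    have h := hp b
    rw [hk] at h
    obtain ⟨w, hw, h⟩ := h
    rw [h6] at hw
    obtain rfl := Option.some.inj hw
    exact h
  refine ⟨by rw [Finsupp.single_le_iff, hk]; omega,
    x, Function.update g (x (listHead b)) (some (σ 7)),
    hc.update_head b fun i hi e => hc.not_range _ i hi (e ▸ h7), ?_, fun b' => ?_, ?_,
      fun i => .inl (hx i), fun u v huv => ?_⟩
  · refine edgeDB_update r σ [(listHead b, 6)] [(listHead b, 7)] fun u v => ?_
    rw [hc.coreEdge_update_head h6]
    simp only [List.mem_singleton, exists_eq_left, hσ]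
  · rcases eq_or_ne b' b with rfl | hb
    · rw [Finsupp.tsub_apply, Finsupp.single_eq_same, hk, Nat.add_sub_cancel]
      have hne6 : ∀ b, σ 6 ≠ x (listHead b) := fun b e => hnr b _ (e ▸ h6)
      cases k with
      | zero =>
        rw [IsPath, h7] at hpk
        rw [IsPath, Function.update_self, hpk]
      | succ k =>
        obtain ⟨w, hw, hpk⟩ := hpk
        rw [h7] at hw
        obtain rfl := Option.some.inj hw
        refine ⟨σ 7, Function.update_self _ _ _, hpk.update (hnr _) fun e => hnr b' _ (e ▸ h7)⟩
    · rw [Finsupp.tsub_apply, Finsupp.single_eq_of_ne hb, Nat.sub_zero]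
      exact (hp b').update (hnr _) (hc.inj.ne (listHead_injective.ne hb))
  · refine hf.union (Set.finite_empty.subset ?_)
    simp [binaryOp]
  · rcases eq_or_ne u (x (listHead b)) with rfl | hu
    · rw [Function.update_self] at huv
      rw [← Option.some.inj huv]
      exact ⟨.inl (hx _), .inl (hH _ _ h7).2⟩
    · rw [Function.update_of_ne hu] at huv
      exact ⟨.inl (hH _ _ huv).1, .inl (hH _ _ huv).2⟩

theorem binaryOp_zero_result (r : ℕ) (b : Bool) (c : Config Δ) (σ : ℕ → Δ) :
    (binaryOp r (.zero b)).result c σ = c := by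
  ext <;> simp [binaryOp, DMSAction.result, substDB]

/-- Fresh inputs are pairwise distinct, which makes the six nodes of the rigid graph distinct. -/
theorem binaryRel_boot {p : ℕ} {σ : ℕ → Δ}
    (hσ : (binaryBoot r).Instantiates (({(p, [])}, ∅) : Config Δ) σ) :
    binaryRel r ((binaryBoot r).result (∅, ∅) σ) 0 := by
  classical
  have hinj : Function.Injective fun i : Fin 6 => σ i := fun i j hij => by
    have hmem : ∀ i : Fin 6, (i : ℕ) ∈ (binaryBoot r).fresh := by
      simp only [binaryBoot]
      decide
    exact Fin.ext (hσ.inj _ (hmem i) _ (hmem j) hij)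
  -- Both heads point directly to the common end node: two lists of length zero.
  let g : Δ → Option Δ := fun u => if u = σ 3 ∨ u = σ 4 then some (σ 5) else none
  have hne : ∀ {i j : Fin 6}, i ≠ j → σ i ≠ σ j := fun hij => hinj.ne hij
  have hg3 : g (σ 3) = some (σ 5) := by simp [g]
  have hg4 : g (σ 4) = some (σ 5) := by simp [g]
  have hg : ∀ {u v}, g u = some v → (u = σ 3 ∨ u = σ 4) ∧ v = σ 5 := by
    intro u v h
    by_cases hu : u = σ 3 ∨ u = σ 4
    · simp only [g, if_pos hu, Option.some.injEq] at h
      exact ⟨hu, h.symm⟩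
    · simp [g, if_neg hu] at h
  have hnone : ∀ i : Fin 6, i ≠ 3 → i ≠ 4 → g (σ i) = none := fun i h3 h4 =>
    if_neg (not_or.2 ⟨hne h3, hne h4⟩)
  have hH : ∀ i : Fin 6, σ i ∈ ((binaryBoot r).result (∅, ∅) σ).2 := fun i => by
    refine .inr ⟨i, ?_, rfl⟩
    revert i
    simp only [binaryBoot]
    decide
  refine ⟨fun i => σ i, g, ⟨hinj, hnone 0 (by decide) (by decide), hnone 1 (by decide) (by decide),
    hnone 2 (by decide) (by decide), hnone 5 (by decide) (by decide), fun u i hi h => ?_,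
      fun u h => ?_⟩, ?_, ?_, ?_, hH, fun u v h => ?_⟩
  · exact hne (i := i) (j := 5) (by omega) (hg h).2
  · obtain ⟨h₁ | h₁, h₂⟩ := hg h
    · exact hne (i := 3) (j := 5) (by decide) (h₁.symm.trans h₂)
    · exact hne (i := 4) (j := 5) (by decide) (h₁.symm.trans h₂)
  · have := edgeDB_update (Ed := fun _ _ => False) (Ed' := CoreEdge (fun i => σ i) g) r σ []
      ((3, 5) :: (4, 5) :: coreEdges.map fun e => ((e.1 : ℕ), (e.2 : ℕ))) fun u v => by
        simp only [false_and, false_or, List.mem_cons, exists_eq_or_imp, List.mem_map]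
        constructor
        · rintro (⟨e, he, rfl, rfl⟩ | h)
          · exact .inr (.inr ⟨_, ⟨e, he, rfl⟩, rfl, rfl⟩)
          · obtain ⟨h₁ | h₁, h₂⟩ := hg h
            · exact .inl ⟨h₁, h₂⟩
            · exact .inr (.inl ⟨h₁, h₂⟩)
        · rintro (⟨rfl, rfl⟩ | ⟨rfl, rfl⟩ | ⟨_, ⟨e, he, rfl⟩, rfl, rfl⟩)
          · exact .inr hg3
          · exact .inr hg4
          · exact .inl ⟨e, he, rfl, rfl⟩
    rw [← this]
    have he : edgeDB r (fun _ _ : Δ => False) = ∅ := by simp [edgeDB]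
    rw [he]
    simp [DMSAction.result, binaryBoot, List.map_map, Function.comp_def]
  · rintro (_ | _)
    · exact hg3
    · exact hg4
  · refine Set.finite_empty.union ((Set.finite_range fun i : Fin 6 => σ i).subset ?_)
    rintro _ ⟨v, hv, rfl⟩
    have : v < 6 := by
      simp only [binaryBoot, List.mem_cons, List.not_mem_nil, or_false] at hv
      omega
    exact ⟨⟨v, this⟩, rfl⟩
  · obtain ⟨h₁ | h₁, rfl⟩ := hg h
    · exact ⟨h₁ ▸ hH 3, hH 5⟩
    · exact ⟨h₁ ▸ hH 4, hH 5⟩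

end Result

/-- The substitution with the values `x` on the first six variables, `y` on the seventh and `z` on
the others. -/
def coreSubst {Δ : Type*} (x : Fin 6 → Δ) (y z : Δ) (u : ℕ) : Δ :=
  if h : u < 6 then x ⟨u, h⟩ else if u = 6 then y else z

theorem coreSubst_fin {Δ : Type*} (x : Fin 6 → Δ) (y z : Δ) (i : Fin 6) :
    coreSubst x y z i = x i := dif_pos i.2

/-- For existence, the guard is satisfied by the intended nodes. For soundness, `IsCore.unique`
forces any satisfying substitution to agree with the intended nodes on the heads, and the extra
atoms of the guard then speak about the list of the counter. -/
theorem binary_simulates {Δ : Type*} [Infinite Δ] (r : ℕ) :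
    Simulates (Δ := Δ) (binaryBoot r) (binaryOp r) (binaryRel r) where
  boot_noProps := by simp [DMSAction.NoProps, binaryBoot, coreEdges]
  op_noProps o := by cases o <;> simp [DMSAction.NoProps, binaryOp]
  rel_noProps := by
    rintro ⟨D, H⟩ n ⟨x, g, -, rfl : D = _, -⟩ f ⟨u, v, -, rfl⟩
    simp
  boot_exists p := by
    obtain ⟨σ, hσ⟩ := Infinite.natEmbedding Δ
    refine ⟨σ, ⟨by simp [binaryBoot], by simp, fun v _ w _ h => hσ h, trivial⟩⟩
  boot_rel p σ hσ := binaryRel_boot hσ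
  op_exists := by
    rintro o ⟨D, H⟩ n n' p ⟨x, g, hc, rfl : D = _, hp, hf, hx, hH⟩ hs
    have hcore : ∀ y z, (coreGuard r).Sat (insert (p, []) (edgeDB r (CoreEdge x g)))
        (coreSubst x y z) := by
      intro y z
      rw [coreGuard_sat]
      intro e he
      rw [coreSubst_fin, coreSubst_fin]
      exact .inr (mem_edgeDB.2 (.inl ⟨e, he, rfl, rfl⟩))
    have hadom : ∀ {u v}, CoreEdge x g u v →
        u ∈ DB.adom (insert (p, []) (edgeDB r (CoreEdge x g))) ∧
          v ∈ DB.adom (insert (p, []) (edgeDB r (CoreEdge x g))) := fun h =>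
      ⟨⟨_, .inr (mem_edgeDB.2 h), by simp⟩, ⟨_, .inr (mem_edgeDB.2 h), by simp⟩⟩
    have hxadom : ∀ i, x i ∈ DB.adom (insert (p, []) (edgeDB r (CoreEdge x g))) := by
      have he : ∀ i, ∃ e ∈ coreEdges, i = e.1 ∨ i = e.2 := by decide
      intro i
      obtain ⟨e, he, rfl | rfl⟩ := he i
      · exact (hadom (.inl ⟨e, he, rfl, rfl⟩)).1
      · exact (hadom (.inl ⟨e, he, rfl, rfl⟩)).2
    have hsadom : ∀ y z, ∀ u < 6, coreSubst x y z u ∈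
        DB.adom (insert (p, []) (edgeDB r (CoreEdge x g))) := fun y z u hu => by
      rw [coreSubst, dif_pos hu]
      exact hxadom _
    cases o with
    | inc b =>
      obtain rfl : n' = _ := hs
      obtain ⟨v, hv⟩ := hf.exists_notMem
      obtain ⟨y, hy⟩ : ∃ y, g (x (listHead b)) = some y := by
        have h := hp b
        generalize n b = k at h
        cases k with
        | zero => exact ⟨_, h⟩
        | succ k => exact ⟨_, h.choose_spec.1⟩
      refine ⟨coreSubst x y v, ⟨?_, ?_, ?_, ?_, hcore _ _⟩,
        binaryRel_inc hc hp hf hx hH (coreSubst_fin _ _ _ _) hy hv⟩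
      · intro u hu
        simp only [binaryOp, List.mem_cons, List.not_mem_nil, or_false] at hu
        rcases Nat.lt_or_ge u 6 with h | h
        · exact hsadom _ _ _ h
        · obtain rfl : u = 6 := by omega
          exact (hadom (.inr hy)).2
      · simpa [binaryOp] using! hv
      · simp [binaryOp]
      · refine .inr (mem_edgeDB.2 (.inr ?_))
        rw [coreSubst_fin]
        exact hy
    | dec b =>
      obtain rfl : n = _ := hs
      have h := hp b
      rw [Finsupp.add_apply, Finsupp.single_eq_same] at h
      obtain ⟨y, hy, h⟩ := h
      obtain ⟨z, hz⟩ : ∃ z, g y = some z := by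
        generalize n' b = k at h
        cases k with
        | zero => exact ⟨_, h⟩
        | succ k => exact ⟨_, h.choose_spec.1⟩
      refine ⟨coreSubst x y z, ⟨?_, ?_, ?_, ?_, ?_, hcore _ _⟩, ?_⟩
      · intro u hu
        simp only [binaryOp, List.mem_cons, List.not_mem_nil, or_false] at hu
        rcases Nat.lt_or_ge u 6 with h | h
        · exact hsadom _ _ _ h
        · obtain rfl | rfl : u = 6 ∨ u = 7 := by omega
          · exact (hadom (.inr hy)).2
          · exact (hadom (.inr hz)).2
      · simp [binaryOp]
      · simp [binaryOp]
      · refine .inr (mem_edgeDB.2 (.inr ?_))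
        rw [coreSubst_fin]
        exact hy
      · exact .inr (mem_edgeDB.2 (.inr hz))
      · have := (binaryRel_dec (r := r) (σ := coreSubst x y z) hc hp hf hx hH
          (coreSubst_fin _ _ _ _) hy hz).2
        rwa [add_tsub_cancel_right] at this
    | zero b =>
      obtain ⟨hz, rfl⟩ := hs
      have h := hp b
      rw [hz] at h
      refine ⟨coreSubst x (x 0) (x 0), ⟨?_, ?_, ?_, ?_, hcore _ _⟩, ?_⟩
      · intro u hu
        simp only [binaryOp, List.mem_cons, List.not_mem_nil, or_false] at hu
        exact hsadom _ _ _ (by omega)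
      · simp [binaryOp]
      · simp [binaryOp]
      · refine .inr (mem_edgeDB.2 (.inr ?_))
        rw [coreSubst_fin]
        exact h
      · rw [binaryOp_zero_result]
        exact ⟨x, g, hc, rfl, hp, hf, hx, hH⟩
  op_sound := by
    rintro o ⟨D, H⟩ n p σ ⟨x, g, hc, rfl : D = _, hp, hf, hx, hH⟩ hσ
    have hmem : ∀ {u v}, (r, [u, v]) ∈ insert (p, []) (edgeDB r (CoreEdge x g)) →
        CoreEdge x g u v := fun {u v} h => by
      rcases h with h | h
      · simp at h
      · exact mem_edgeDB.1 h
    have hcore : (coreGuard r).Sat (insert (p, []) (edgeDB r (CoreEdge x g))) σ →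
        (∀ b, σ (listHead b) = x (listHead b)) ∧ (σ 5 = x 0 ∨ σ 5 = x 4 ∨ σ 5 = x 5) := by
      intro h
      rw [coreGuard_sat] at h
      have := hc.unique (y := fun i => σ i) fun e he => hmem (h e he)
      exact ⟨fun b => this.1 _ (listHead_lt b), this.2⟩
    have hsat := hσ.sat
    cases o with
    | inc b =>
      obtain ⟨h6, hsat⟩ := hsat
      have hh := (hcore hsat).1 b
      replace h6 := hmem h6
      rw [hh, hc.edge_of_ge (listHead_ge b)] at h6
      exact ⟨_, rfl, binaryRel_inc hc hp hf hx hH hh h6 (hσ.hist_fresh 7 (by simp [binaryOp]))⟩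
    | dec b =>
      obtain ⟨h6, h7, hsat⟩ := hsat
      have hh := (hcore hsat).1 b
      replace h6 := hmem h6
      replace h7 := hmem h7
      rw [hh, hc.edge_of_ge (listHead_ge b)] at h6
      -- As a successor under `g`, `σ 6` is none of the first five core nodes, so its own out-edge
      -- also comes from `g`.
      have hne : ∀ i < 5, σ 6 ≠ x i := fun i hi e => hc.not_range _ i hi (e ▸ h6)
      rw [IsCore.edge_of_ne (hne 0 (by decide)) (hne 1 (by decide)) (hne 2 (by decide))] at h7
      obtain ⟨hle, hr⟩ := binaryRel_dec (r := r) hc hp hf hx hH hh h6 h7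
      exact ⟨_, (tsub_add_cancel_of_le hle).symm, hr⟩
    | zero b =>
      obtain ⟨h5, hsat⟩ := hsat
      obtain ⟨hh, h5'⟩ := hcore hsat
      replace h5 := hmem h5
      rw [hh, hc.edge_of_ge (listHead_ge b)] at h5
      -- The edge from the head to `σ 5` comes from `g`, which never leads to `x 0` or `x 4`.
      have e5 : σ 5 = x 5 := by
        rcases h5' with e | e | e
        · exact absurd (e ▸ h5) (hc.not_range _ 0 (by decide))
        · exact absurd (e ▸ h5) (hc.not_range _ 4 (by decide))
        · exact e
      refine ⟨n, ⟨?_, rfl⟩, ?_⟩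
      -- A nonempty list would have to continue beyond the end node, where `g` is undefined.
      · by_contra h0
        obtain ⟨k, hk⟩ := Nat.exists_eq_succ_of_ne_zero h0
        have h := hp b
        rw [hk] at h
        obtain ⟨w, hw, h⟩ := h
        rw [h5] at hw
        obtain rfl := Option.some.inj hw
        rw [e5] at h
        cases k with
        | zero => rw [IsPath, hc.g_five] at h; cases h
        | succ k =>
          obtain ⟨w, hw, -⟩ := h
          rw [hc.g_five] at hw
          cases hw
      · rw [binaryOp_zero_result]
        exact ⟨x, g, hc, rfl, hp, hf, hx, hH⟩

/-! ### Undecidability -/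

theorem undecidable_of_two_mem (Δ : Type*) [Infinite Δ] {N : List ℕ} (h0 : 0 ∉ N) (h2 : 2 ∈ N) :
    ¬ ModelCheckingDecidable Δ (fun S => S.HasArities N ∧ S.UCQGuards) ∧
      ¬ PropReachDecidable Δ (fun S => S.HasArities N ∧ S.UCQGuards) ∧
      ¬ RunReachDecidable Δ (fun S => S.HasArities N ∧ S.UCQGuards) := by
  obtain ⟨r, hr⟩ := List.mem_iff_getElem?.1 h2
  exact (binary_simulates r).undecidable (binaryBoot_wf hr) (binaryOp_wf hr) fun m s E =>
    ⟨counterDMS_hasArities h0 _ _ m s E, counterDMS_ucqGuards .tru (binaryOp_isConj r) m s E⟩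

theorem undecidable_of_two_le_count_one (Δ : Type*) [Infinite Δ] {N : List ℕ} (h0 : 0 ∉ N)
    (h1 : 2 ≤ N.count 1) :
    ¬ ModelCheckingDecidable Δ (fun S => S.HasArities N) ∧
      ¬ PropReachDecidable Δ (fun S => S.HasArities N) ∧
      ¬ RunReachDecidable Δ (fun S => S.HasArities N) := by
  obtain ⟨i, j, hij, hi, hj⟩ :=
    List.duplicate_iff_exists_distinct_get.1 (List.duplicate_iff_two_le_count.2 h1)
  let r : Bool → ℕ := fun b => bif b then j else i
  have hinj : Function.Injective r := by
    have : (i : ℕ) ≠ j := (Fin.lt_def.1 hij).ne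
    rintro (_ | _) (_ | _) h
    · rfl
    · exact absurd h this
    · exact absurd h.symm this
    · rfl
  have hr : ∀ b, N[r b]? = some 1 := by
    rintro (_ | _)
    · exact List.getElem?_eq_some_iff.2 ⟨i.2, hi.symm⟩
    · exact List.getElem?_eq_some_iff.2 ⟨j.2, hj.symm⟩
  exact (unary_simulates hinj).undecidable (DMSAction.idle_wf N) (unaryOp_wf hr) fun m s E =>
    counterDMS_hasArities h0 _ _ m s E

theorem theorem4p1 (Δ : Type*) [Countable Δ] [Infinite Δ] :
    (¬ ModelCheckingDecidable Δ (fun _ => True) ∧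
      ¬ PropReachDecidable Δ (fun _ => True) ∧
      ¬ RunReachDecidable Δ (fun _ => True)) ∧
    (∀ N : List ℕ, 0 ∉ N → 2 ∈ N →
      ¬ ModelCheckingDecidable Δ (fun S => S.HasArities N ∧ S.UCQGuards) ∧
      ¬ PropReachDecidable Δ (fun S => S.HasArities N ∧ S.UCQGuards) ∧
      ¬ RunReachDecidable Δ (fun S => S.HasArities N ∧ S.UCQGuards)) ∧
    (∀ N : List ℕ, 0 ∉ N → 2 ≤ N.count 1 →
      ¬ ModelCheckingDecidable Δ (fun S => S.HasArities N) ∧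
      ¬ PropReachDecidable Δ (fun S => S.HasArities N) ∧
      ¬ RunReachDecidable Δ (fun S => S.HasArities N)) := by
  refine ⟨?_, fun N h0 h2 => undecidable_of_two_mem Δ h0 h2,
    fun N h0 h1 => undecidable_of_two_le_count_one Δ h0 h1⟩
  -- An algorithm for all systems would in particular decide the systems with a single binary
  -- relation and UCQ guards.
  obtain ⟨h₁, h₂, h₃⟩ := undecidable_of_two_mem Δ (N := [2]) (by simp) (by simp)
  exact ⟨fun h => h₁ (h.mono fun _ hx => ⟨hx.1, trivial, hx.2.2⟩),
    fun h => h₂ (h.mono fun _ hx => ⟨hx.1, trivial, hx.2.2⟩),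
    fun h => h₃ (h.mono fun _ hx => ⟨hx.1, trivial, hx.2.2⟩)⟩
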